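/- Let $T\ge 0$, let $U\subseteq\mathbb R^m$ be closed and convex with $0\in U$, and let $A:[0,T]\times\mathbb R^n\to\mathbb R^n$, $B:[0,T]\times\mathbb R^n\to\mathbb R^{n\times m}$, $Q:[0,T]\times\mathbb R^n\to\mathbb R$, $S:[0,T]\times\mathbb R^n\to\mathbb R^m$, $R:[0,T]\times\mathbb R^n\to\mathbb S^m$ (the symmetric $m\times m$ matrices) and $G:\mathbb R^n\to\mathbb R$ be given. For $t\in[0,T]$ let $\mathcal U[t,T]$ be the set of $u\in L^2(t,T;\mathbb R^m)$ with $u(s)\in U$ for a.e. $s\in[t,T]$. For $x\in\mathbb R^n$ and $u\in\mathcal U[t,T]$ consider the state equation $$\dot X(s)=A(s,X(s))+B(s,X(s))u(s),\quad s\in[t,T],\qquad X(t)=x,$$ (understood in the sense of Carathéodory, i.e. in integrated form) and the cost $$J(t,x;u)=\int_t^T\Big[Q(s,X(s))+\langle S(s,X(s)),u(s)\rangle+\tfrac12\langle R(s,X(s))u(s),u(s)\rangle\Big]ds+G(X(T)).$$ Assume: (H1) $A$ and $B$ are continuous, and there are constants $L_A,L_B,\tilde L_B>0$ such that for all $t\in[0,T]$,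 $x,\bar x\in\mathbb R^n$, $u\in U$: $|A(t,x)-A(t,\bar x)|\le L_A|x-\bar x|$, $|B(t,x)-B(t,\bar x)|\le\tilde L_B|x-\bar x|$, and $\langle[B(t,x)-B(t,\bar x)]^{\mathsf T}(x-\bar x),u\rangle\le L_B|x-\bar x|^2$. (H2) $Q,S,R,G$ are continuous, and there are constants $L,Q_0,G_0,S_0,\rho_0>0$, $\varepsilon_0\in(0,1)$ and a continuous $\rho:\mathbb R^n\to[\rho_0,\infty)$ such that for all $(t,x)\in[0,T]\times\mathbb R^n$: $R(t,x)\ge\rho(x)I$; $(1-\varepsilon_0)Q(t,x)-\tfrac12S(t,x)^{\mathsf T}R(t,x)^{-1}S(t,x)\ge-L$; $G(x)\ge-L$; $Q(t,x)\le Q_0(1+|x|^2)$; $G(x)\le G_0(1+|x|^2)$; $|S(t,x)|\le S_0(1+|x|)$; $|A(t,x)+B(t,x)R(t,x)^{-1}S(t,x)|\le L(1+|x|)$; $|B(t,x)R(t,x)^{-1}B(t,x)^{\mathsf T}|\le L$. Then for every initial pair $(t,x)\in[0,T]\times\mathbb R^n$ the problem is well posed (for each $u\in\mathcal U[t,T]$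 the state equation has a unique solution $X$ on $[t,T]$, and the integrand of $J(t,x;u)$ is integrable), and there is an optimal control: some $u^*\in\mathcal U[t,T]$ with $$J(t,x;u^*)=\inf_{u\in\mathcal U[t,T]}J(t,x;u).$$ -/

import Mathlib

open MeasureTheory Set
open scoped Matrix.Norms.L2Operator

/-- The Euclidean space of dimension `n`. -/
abbrev Euc (n : ℕ) : Type := EuclideanSpace ℝ (Fin n)

/-- The Euclidean vector `M v`, for a real matrix `M` and a Euclidean vector `v`. -/
noncomputable abbrev Matrix.act {k l : ℕ} (M : Matrix (Fin k) (Fin l) ℝ) (v : Euc l) : Euc k :=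
  Matrix.toEuclideanLin M v

/-- The data of an affine-quadratic optimal control problem: the horizon `T`, the set `U` of
control values, the coefficients `A`, `B` of the state equation and the coefficients
`Q`, `S`, `R`, `G` of the cost functional. Only times in `[0, T]` matter. -/
structure AQData (n m : ℕ) where
  T : ℝ
  U : Set (Euc m)
  A : ℝ → Euc n → Euc n
  B : ℝ → Euc n → Matrix (Fin n) (Fin m) ℝ
  Q : ℝ → Euc n → ℝ
  S : ℝ → Euc n → Euc m
  R : ℝ → Euc n → Matrix (Fin m) (Fin m) ℝ
  G : Euc n → ℝ

namespace AQData

variable {n m : ℕ}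

/-- The strip `[0, T] × ℝⁿ`. -/
def strip (D : AQData n m) : Set (ℝ × Euc n) := Icc 0 D.T ×ˢ univ

/-- Hypothesis (H1) on the state equation. Matrices carry the operator norm. -/
structure H1 (D : AQData n m) : Prop where
  continuous_A : ContinuousOn (fun p : ℝ × Euc n => D.A p.1 p.2) D.strip
  continuous_B : ContinuousOn (fun p : ℝ × Euc n => D.B p.1 p.2) D.strip
  lipschitz_A : ∃ LA > (0 : ℝ), ∀ t ∈ Icc 0 D.T, ∀ x y : Euc n,
    ‖D.A t x - D.A t y‖ ≤ LA * ‖x - y‖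
  lipschitz_B : ∃ LB' > (0 : ℝ), ∀ t ∈ Icc 0 D.T, ∀ x y : Euc n,
    ‖D.B t x - D.B t y‖ ≤ LB' * ‖x - y‖
  one_sided_B : ∃ LB > (0 : ℝ), ∀ t ∈ Icc 0 D.T, ∀ u ∈ D.U, ∀ x y : Euc n,
    inner ℝ ((D.B t x - D.B t y).transpose.act (x - y)) u ≤ LB * ‖x - y‖ ^ 2

/-- Hypothesis (H2) on the cost functional. `R ≥ ρ I` is the Loewner order. -/
structure H2 (D : AQData n m) : Prop where
  continuous_Q : ContinuousOn (fun p : ℝ × Euc n => D.Q p.1 p.2) D.strip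
  continuous_S : ContinuousOn (fun p : ℝ × Euc n => D.S p.1 p.2) D.strip
  continuous_R : ContinuousOn (fun p : ℝ × Euc n => D.R p.1 p.2) D.strip
  continuous_G : Continuous D.G
  symm_R : ∀ t ∈ Icc 0 D.T, ∀ x : Euc n, (D.R t x).IsSymm
  bounds : ∃ L > (0 : ℝ), ∃ Q₀ > (0 : ℝ), ∃ G₀ > (0 : ℝ), ∃ S₀ > (0 : ℝ),
    ∃ ε₀ ∈ Ioo (0 : ℝ) 1, ∃ ρ₀ > (0 : ℝ), ∃ ρ : Euc n → ℝ,
      Continuous ρ ∧ (∀ x, ρ₀ ≤ ρ x) ∧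
      ∀ t ∈ Icc 0 D.T, ∀ x : Euc n,
        (D.R t x - ρ x • (1 : Matrix (Fin m) (Fin m) ℝ)).PosSemidef ∧
        -L ≤ (1 - ε₀) * D.Q t x - 1 / 2 * inner ℝ (D.S t x) ((D.R t x)⁻¹.act (D.S t x)) ∧
        -L ≤ D.G x ∧
        D.Q t x ≤ Q₀ * (1 + ‖x‖ ^ 2) ∧
        D.G x ≤ G₀ * (1 + ‖x‖ ^ 2) ∧
        ‖D.S t x‖ ≤ S₀ * (1 + ‖x‖) ∧
        ‖D.A t x + (D.B t x).act ((D.R t x)⁻¹.act (D.S t x))‖ ≤ L * (1 + ‖x‖) ∧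
        ‖D.B t x * (D.R t x)⁻¹ * (D.B t x).transpose‖ ≤ L

/-- The set `𝒰[t, T]` of admissible controls: the square integrable functions on `[t, T]` with
values in `U` almost everywhere (functions stand for their almost-everywhere classes). -/
def Admissible (D : AQData n m) (t : ℝ) : Set (ℝ → Euc m) :=
  {u | MemLp u 2 (volume.restrict (Icc t D.T)) ∧ ∀ᵐ s ∂(volume.restrict (Icc t D.T)), u s ∈ D.U}

/-- `X` solves the state equation `X' = A(s, X) + B(s, X) u` on `[t, T]`, `X(t) = x`, in the sense
of Carathéodory, that is, in integrated form. -/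
structure IsTrajectory (D : AQData n m) (t : ℝ) (x : Euc n) (u : ℝ → Euc m) (X : ℝ → Euc n) :
    Prop where
  continuousOn : ContinuousOn X (Icc t D.T)
  integrable : IntegrableOn (fun r => D.A r (X r) + (D.B r (X r)).act (u r)) (Icc t D.T)
  eq_integral : ∀ s ∈ Icc t D.T, X s = x + ∫ r in t..s, (D.A r (X r) + (D.B r (X r)).act (u r))

/-- The integrand of the cost functional, along a trajectory `X` with control `u`. -/
noncomputable def runningCost (D : AQData n m) (X : ℝ → Euc n) (u : ℝ → Euc m) (s : ℝ) : ℝ :=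
  D.Q s (X s) + inner ℝ (D.S s (X s)) (u s) + 1 / 2 * inner ℝ ((D.R s (X s)).act (u s)) (u s)

/-- The cost functional, and the state equation behind it, are well defined for the initial pair
`(t, x)`: for each admissible control the state equation has a solution, unique on `[t, T]`, along
which the running cost is integrable. -/
def WellPosed (D : AQData n m) (t : ℝ) (x : Euc n) : Prop :=
  ∀ u ∈ D.Admissible t, ∃ X, D.IsTrajectory t x u X ∧
    (∀ Y, D.IsTrajectory t x u Y → EqOn Y X (Icc t D.T)) ∧
    IntegrableOn (D.runningCost X u) (Icc t D.T)

open Classical in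
/-- The solution `X(·; t, x, u)` of the state equation (the zero function if there is none). -/
noncomputable def state (D : AQData n m) (t : ℝ) (x : Euc n) (u : ℝ → Euc m) : ℝ → Euc n :=
  if h : ∃ X, D.IsTrajectory t x u X then h.choose else 0

/-- The cost functional `J(t, x; u)`. -/
noncomputable def J (D : AQData n m) (t : ℝ) (x : Euc n) (u : ℝ → Euc m) : ℝ :=
  (∫ s in t..D.T, D.runningCost (D.state t x u) u s) + D.G (D.state t x u D.T)

/-- `u` is an optimal control for `(t, x)`: it is admissible and attains the infimum of the cost
functional over all admissible controls. -/
def IsOptimalControl (D : AQData n m) (t : ℝ) (x : Euc n) (u : ℝ → Euc m) : Prop :=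
  u ∈ D.Admissible t ∧ ∀ v ∈ D.Admissible t, D.J t x u ≤ D.J t x v

end AQData

open Filter Topology

/-! ### Matrices acting on Euclidean vectors. -/

section MatrixAction

variable {k l p : ℕ}

/-! The proof is the direct method: a minimizing sequence of controls is bounded in `L²`, a
subsequence converges weakly to some `v`, and the cost is lower semicontinuous along it.

The difficulty is boundedness, since `B` may grow with the state. Completing the square with `p =
R⁻¹S` shows that the Lagrangian plus a constant dominates `½⟨R(u + p), u + p⟩`, and the bound on `B
R⁻¹ Bᵀ` turns this into a bound on `|B(u + p)|²`. What remains of the velocity grows linearly in the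
state, so bounded cost gives `∫|X'|² ≤ const + const ∫|X|²` (`H2.exists_velocity_bound`), and
Grönwall bounds the states uniformly (`H2.exists_state_bound`). On bounded states the Lagrangian is
coercive in `u`, which bounds the controls (`H2.exists_control_bound`).

The weak limit satisfies the constraint because `U` is closed and convex (`WeakL2Tendsto.ae_mem`).
The state equation is affine in the control, so the trajectories converge pointwise
(`H1.tendsto_trajectory`). The running cost is convex in the control; replacing its quadratic part
by the tangent at `v` leaves terms affine in `u k`, where weak convergence suffices
(`H2.integral_runningCost_le`).

Well-posedness is Picard iteration with a Lipschitz bound `a + b‖u‖` that is only square integrable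
in time (`exists_eq_integral`, `eqOn_of_eq_integral`). -/

lemma Matrix.norm_act_le (M : Matrix (Fin k) (Fin l) ℝ) (v : Euc l) : ‖M.act v‖ ≤ ‖M‖ * ‖v‖ :=
  (Matrix.toEuclideanLin (n := Fin l) (m := Fin k) (𝕜 := ℝ) |>.trans
    LinearMap.toContinuousLinearMap M).le_opNorm v

lemma Matrix.sub_act (M N : Matrix (Fin k) (Fin l) ℝ) (v : Euc l) :
    (M - N).act v = M.act v - N.act v := by
  simp [Matrix.act]

lemma Matrix.mul_act (M : Matrix (Fin k) (Fin l) ℝ) (N : Matrix (Fin l) (Fin p) ℝ) (v : Euc p) :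
    (M * N).act v = M.act (N.act v) := by
  ext i
  simp [Matrix.act, Matrix.toLpLin_apply]

lemma Matrix.inner_act_left (M : Matrix (Fin k) (Fin l) ℝ) (v : Euc l) (w : Euc k) :
    inner ℝ (M.act v) w = inner ℝ v (M.transpose.act w) := by
  have := Matrix.toEuclideanLin_conjTranspose_eq_adjoint (𝕜 := ℝ) M
  rw [Matrix.conjTranspose_eq_transpose_of_trivial] at this
  rw [Matrix.act, Matrix.act, this, LinearMap.adjoint_inner_right]

lemma Matrix.continuous_act :
    Continuous fun q : Matrix (Fin k) (Fin l) ℝ × Euc l => q.1.act q.2 := by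
  have h : Continuous fun q : Matrix (Fin k) (Fin l) ℝ × Euc l =>
      WithLp.toLp 2 (q.1.mulVec q.2.ofLp) := by
    refine (PiLp.continuous_toLp 2 _).comp ?_
    exact Continuous.matrix_mulVec continuous_fst ((PiLp.continuous_ofLp 2 _).comp continuous_snd)
  exact h

end MatrixAction

/-! ### Square integrable functions and weak convergence. -/

section SquareIntegrable

variable {α : Type*} [MeasurableSpace α] {μ : Measure α}
variable {E : Type*} [NormedAddCommGroup E] [InnerProductSpace ℝ E]

lemma MeasureTheory.MemLp.integrable_inner_of_two {f g : α → E} (hf : MemLp f 2 μ)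
    (hg : MemLp g 2 μ) : Integrable (fun a => inner ℝ (f a) (g a)) μ := by
  refine Integrable.mono' (hf.norm.integrable_mul hg.norm)
    (hf.aestronglyMeasurable.inner hg.aestronglyMeasurable) (ae_of_all _ fun a => ?_)
  exact norm_inner_le_norm _ _

/-- Cauchy–Schwarz: the quadratic `c ↦ ∫ (c f + g)²` is nonnegative, so its discriminant is not
positive. -/
lemma integral_mul_sq_le {f g : α → ℝ} (hf : MemLp f 2 μ) (hg : MemLp g 2 μ) :
    (∫ a, f a * g a ∂μ) ^ 2 ≤ (∫ a, f a ^ 2 ∂μ) * ∫ a, g a ^ 2 ∂μ := by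
  have hfg : Integrable (fun a => f a * g a) μ := hf.integrable_mul hg
  have key : ∀ c : ℝ, 0 ≤ (∫ a, f a ^ 2 ∂μ) * (c * c) + (2 * ∫ a, f a * g a ∂μ) * c
      + ∫ a, g a ^ 2 ∂μ := by
    intro c
    have h : ∫ a, (c * f a + g a) ^ 2 ∂μ = (∫ a, f a ^ 2 ∂μ) * (c * c)
        + (2 * ∫ a, f a * g a ∂μ) * c + ∫ a, g a ^ 2 ∂μ := by
      rw [← integral_mul_const, ← integral_const_mul, ← integral_mul_const, ← integral_add,
        ← integral_add]
      · congr 1; ext a; ring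
      · exact (hf.integrable_sq.mul_const _).add ((hfg.const_mul 2).mul_const c)
      · exact hg.integrable_sq
      · exact hf.integrable_sq.mul_const _
      · exact (hfg.const_mul 2).mul_const c
    rw [← h]
    positivity
  have := discrim_le_zero key
  rw [discrim] at this
  nlinarith

lemma abs_integral_inner_le {f g : α → E} (hf : MemLp f 2 μ) (hg : MemLp g 2 μ) :
    |∫ a, inner ℝ (f a) (g a) ∂μ| ≤ √(∫ a, ‖f a‖ ^ 2 ∂μ) * √(∫ a, ‖g a‖ ^ 2 ∂μ) := by
  have h1 : |∫ a, inner ℝ (f a) (g a) ∂μ| ≤ ∫ a, ‖f a‖ * ‖g a‖ ∂μ := by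
    rw [← Real.norm_eq_abs]
    exact norm_integral_le_of_norm_le (g := fun a => ‖f a‖ * ‖g a‖)
      (hf.norm.integrable_mul hg.norm) (ae_of_all _ fun a => norm_inner_le_norm _ _)
  refine h1.trans ?_
  rw [← Real.sqrt_mul (by positivity)]
  exact Real.le_sqrt_of_sq_le (integral_mul_sq_le hf.norm hg.norm)

lemma tendsto_integral_norm_sub_sq {F : Type*} [NormedAddCommGroup F]
    {g : ℕ → α → F} {g' : α → F} {h : α → ℝ}
    (hh : MemLp h 2 μ) (hg : ∀ k, AEStronglyMeasurable (g k) μ)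
    (hb : ∀ k, ∀ᵐ a ∂μ, ‖g k a‖ ≤ h a)
    (hlim : ∀ᵐ a ∂μ, Tendsto (fun k => g k a) atTop (𝓝 (g' a))) :
    MemLp g' 2 μ ∧ Tendsto (fun k => ∫ a, ‖g k a - g' a‖ ^ 2 ∂μ) atTop (𝓝 0) := by
  have hm : AEStronglyMeasurable g' μ := aestronglyMeasurable_of_tendsto_ae atTop hg hlim
  have hb' : ∀ᵐ a ∂μ, ‖g' a‖ ≤ h a := by
    filter_upwards [ae_all_iff.2 hb, hlim] with a h1 h2
    exact le_of_tendsto h2.norm (Eventually.of_forall h1)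
  refine ⟨hh.mono' hm hb', ?_⟩
  have := tendsto_integral_of_dominated_convergence (μ := μ)
    (F := fun k a => ‖g k a - g' a‖ ^ 2) (f := fun _ => 0) (fun a => 4 * h a ^ 2)
    (fun k => ((hg k).sub hm).norm.pow 2) (hh.integrable_sq.const_mul 4) ?_ ?_
  · simpa using this
  · intro k
    filter_upwards [hb k, hb'] with a h1 h2
    have h3 := norm_sub_le (g k a) (g' a)
    rw [Real.norm_of_nonneg (by positivity)]
    have h4 : ‖g k a - g' a‖ ≤ 2 * h a := by linarith
    calc ‖g k a - g' a‖ ^ 2 ≤ (2 * h a) ^ 2 := pow_le_pow_left₀ (norm_nonneg _) h4 2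
      _ = 4 * h a ^ 2 := by ring
  · filter_upwards [hlim] with a h1
    have h2 : Tendsto (fun k => ‖g k a - g' a‖) atTop (𝓝 0) := by
      rw [← tendsto_iff_norm_sub_tendsto_zero]
      exact h1
    simpa using h2.pow 2

/-- Weak convergence in `L²(μ; E)`. -/
def WeakL2Tendsto (μ : Measure α) (u : ℕ → α → E) (v : α → E) : Prop :=
  ∀ g : α → E, MemLp g 2 μ →
    Tendsto (fun k => ∫ a, inner ℝ (g a) (u k a) ∂μ) atTop (𝓝 (∫ a, inner ℝ (g a) (v a) ∂μ))

/-- Pairing a strongly convergent sequence with a bounded, weakly convergent one: dominated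
convergence makes `g k → g'` strong in `L²`, so replacing `g k` by `g'` costs at most `‖g k - g'‖
√C`. -/
lemma WeakL2Tendsto.tendsto_integral_inner {u : ℕ → α → E} {v : α → E}
    (huv : WeakL2Tendsto μ u v) (hu : ∀ k, MemLp (u k) 2 μ) {C : ℝ}
    (hC : ∀ k, ∫ a, ‖u k a‖ ^ 2 ∂μ ≤ C) {g : ℕ → α → E} {g' : α → E} {h : α → ℝ}
    (hh : MemLp h 2 μ) (hg : ∀ k, AEStronglyMeasurable (g k) μ)
    (hb : ∀ k, ∀ᵐ a ∂μ, ‖g k a‖ ≤ h a)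
    (hlim : ∀ᵐ a ∂μ, Tendsto (fun k => g k a) atTop (𝓝 (g' a))) :
    Tendsto (fun k => ∫ a, inner ℝ (g k a) (u k a) ∂μ) atTop
      (𝓝 (∫ a, inner ℝ (g' a) (v a) ∂μ)) := by
  obtain ⟨hg', hz⟩ := tendsto_integral_norm_sub_sq hh hg hb hlim
  have hgk : ∀ k, MemLp (g k) 2 μ := fun k => hh.mono' (hg k) (hb k)
  have h1 : Tendsto (fun k => ∫ a, inner ℝ (g k a - g' a) (u k a) ∂μ) atTop (𝓝 0) := by
    refine squeeze_zero_norm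
      (a := fun k => √(∫ a, ‖g k a - g' a‖ ^ 2 ∂μ) * √C) (fun k => ?_) ?_
    · refine (abs_integral_inner_le ((hgk k).sub hg') (hu k)).trans ?_
      exact mul_le_mul_of_nonneg_left (Real.sqrt_le_sqrt (hC k)) (Real.sqrt_nonneg _)
    · simpa using (hz.sqrt).mul_const (√C)
  have h2 := h1.add (huv g' hg')
  rw [zero_add] at h2
  refine h2.congr fun k => ?_
  have h3 : Integrable (fun a => inner ℝ (g k a - g' a) (u k a)) μ :=
    ((hgk k).sub hg').integrable_inner_of_two (hu k)
  rw [← integral_add h3 (hg'.integrable_inner_of_two (hu k))]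
  refine integral_congr_ae (ae_of_all _ fun a => ?_)
  simp [inner_sub_left]

lemma MeasureTheory.Lp.inner_toLp {f g : α → E} (hf : MemLp f 2 μ) (hg : MemLp g 2 μ) :
    inner ℝ (hf.toLp f) (hg.toLp g) = ∫ a, inner ℝ (f a) (g a) ∂μ := by
  rw [L2.inner_def]
  refine integral_congr_ae ?_
  filter_upwards [hf.coeFn_toLp, hg.coeFn_toLp] with a h1 h2
  rw [h1, h2]

/-- Bounded sequences in a separable Hilbert space have weakly convergent subsequences. -/
lemma exists_subseq_tendsto_inner {H : Type*} [NormedAddCommGroup H] [InnerProductSpace ℝ H]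
    [CompleteSpace H] [TopologicalSpace.SeparableSpace H] {f : ℕ → H} {C : ℝ}
    (hf : ∀ k, ‖f k‖ ≤ C) :
    ∃ φ : ℕ → ℕ, StrictMono φ ∧ ∃ f' : H, ∀ g : H,
      Tendsto (fun k => inner ℝ g (f (φ k))) atTop (𝓝 (inner ℝ g f')) := by
  -- Sequential Banach–Alaoglu in the dual, carried back to `H` by the Riesz isomorphism.
  have hs := WeakDual.isSeqCompact_closedBall (𝕜 := ℝ) (E := H) 0 C
  obtain ⟨ψ, -, φ, hφ, hlim⟩ := hs (x := fun k => StrongDual.toWeakDual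
    (InnerProductSpace.toDual ℝ H (f k))) (fun k => by simpa using hf k)
  refine ⟨φ, hφ, (InnerProductSpace.toDual ℝ H).symm (WeakDual.toStrongDual ψ), fun g => ?_⟩
  have h := (WeakDual.eval_continuous (𝕜 := ℝ) (E := H) g).continuousAt.tendsto.comp hlim
  have h1 : inner ℝ g ((InnerProductSpace.toDual ℝ H).symm (WeakDual.toStrongDual ψ)) = ψ g := by
    rw [real_inner_comm, InnerProductSpace.toDual_symm_apply]
    rfl
  rw [h1]
  refine h.congr fun k => ?_
  rw [real_inner_comm]
  rfl

lemma exists_subseq_weakL2Tendsto [CompleteSpace E] [TopologicalSpace.SeparableSpace E]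
    [IsSeparable μ] {u : ℕ → α → E} (hu : ∀ k, MemLp (u k) 2 μ)
    {C : ℝ} (hC : ∀ k, ∫ a, ‖u k a‖ ^ 2 ∂μ ≤ C) :
    ∃ φ : ℕ → ℕ, StrictMono φ ∧ ∃ v, MemLp v 2 μ ∧ WeakL2Tendsto μ (fun k => u (φ k)) v := by
  have hn : ∀ k, ‖(hu k).toLp (u k)‖ ≤ √C := by
    intro k
    refine Real.le_sqrt_of_sq_le ?_
    rw [← real_inner_self_eq_norm_sq, Lp.inner_toLp]
    simpa only [real_inner_self_eq_norm_sq] using hC k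
  -- Needed by the instance that makes `L²` separable.
  have : Fact ((2 : ENNReal) ≠ ⊤) := ⟨by simp⟩
  obtain ⟨φ, hφ, f, hf⟩ := exists_subseq_tendsto_inner hn
  refine ⟨φ, hφ, f, Lp.memLp f, fun g hg => ?_⟩
  have := hf (hg.toLp g)
  simp only [Lp.inner_toLp] at this
  convert this using 2
  conv_rhs => rw [← Lp.toLp_coeFn f (Lp.memLp f)]
  rw [Lp.inner_toLp]

/-- The constraint `u ∈ U` almost everywhere passes to weak limits if `U` is closed and convex. -/
lemma WeakL2Tendsto.ae_mem [CompleteSpace E] {u : ℕ → α → E} {v : α → E}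
    (huv : WeakL2Tendsto μ u v) (hu : ∀ k, MemLp (u k) 2 μ) (hv : MemLp v 2 μ) {U : Set E}
    (hUc : IsClosed U) (hUv : Convex ℝ U) (hU : ∀ k, ∀ᵐ a ∂μ, u k a ∈ U) :
    ∀ᵐ a ∂μ, v a ∈ U := by
  set K : Set (Lp E 2 μ) := {f | ∀ᵐ a ∂μ, f a ∈ U} with hK
  have hKv : Convex ℝ K := by
    intro f hf g hg a b ha hb hab
    filter_upwards [hf, hg, Lp.coeFn_add (a • f) (b • g), Lp.coeFn_smul a f, Lp.coeFn_smul b g]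
      with x h1 h2 h3 h4 h5
    rw [h3, Pi.add_apply, h4, h5]
    exact hUv h1 h2 ha hb hab
  -- An `L²`-convergent sequence has an a.e. convergent subsequence, and `U` is closed.
  have hKc : IsClosed K := by
    refine IsSeqClosed.isClosed fun f f' hf hff' => ?_
    obtain ⟨ns, -, hns⟩ := (tendstoInMeasure_of_tendsto_Lp hff').exists_seq_tendsto_ae
    filter_upwards [hns, ae_all_iff.2 hf] with a h1 h2
    exact hUc.mem_of_tendsto h1 (Eventually.of_forall fun k => h2 _)
  -- Otherwise Hahn–Banach separates `v` from `K`; the separating functional is an inner product,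
  -- hence passes to the weak limit, a contradiction.
  have hvK : hv.toLp v ∈ K := by
    by_contra hcon
    obtain ⟨F, r, h1, h2⟩ := geometric_hahn_banach_closed_point hKv hKc hcon
    set g := (InnerProductSpace.toDual ℝ (Lp E 2 μ)).symm F with hg
    have hF : ∀ f, F f = inner ℝ g f := fun f => by rw [hg, InnerProductSpace.toDual_symm_apply]
    have hFe : ∀ (w : α → E) (hw : MemLp w 2 μ), F (hw.toLp w) = ∫ a, inner ℝ (g a) (w a) ∂μ := by
      intro w hw
      rw [hF, ← Lp.inner_toLp (Lp.memLp g) hw, Lp.toLp_coeFn]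
    have h3 := huv g (Lp.memLp g)
    rw [← hFe v hv] at h3
    have h4 : F (hv.toLp v) ≤ r := by
      refine le_of_tendsto h3 (Eventually.of_forall fun k => ?_)
      rw [← hFe _ (hu k)]
      refine (h1 _ ?_).le
      filter_upwards [(hu k).coeFn_toLp, hU k] with a h5 h6
      rwa [h5]
    linarith
  filter_upwards [hvK, hv.coeFn_toLp] with a h1 h2
  rwa [← h2]

end SquareIntegrable

/-! ### Grönwall's inequality. -/

section Gronwall

variable {t T : ℝ}

/-- Integral form of Grönwall's inequality. -/
lemma integral_le_of_le_add_mul_integral {φ a : ℝ → ℝ} {C : ℝ} (hC : 0 ≤ C)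
    (hφ : ContinuousOn φ (Icc t T)) (ha : ContinuousOn a (Icc t T))
    (ha0 : ∀ s ∈ Icc t T, 0 ≤ a s)
    (h : ∀ s ∈ Icc t T, φ s ≤ a s + C * ∫ r in t..s, φ r) {s : ℝ} (hs : s ∈ Icc t T) :
    ∫ r in t..s, φ r ≤ Real.exp (C * (s - t)) * ∫ r in t..s, a r := by
  have htT : t ≤ T := hs.1.trans hs.2
  have hder : ∀ f : ℝ → ℝ, ContinuousOn f (Icc t T) → ∀ r ∈ Ioo t T,
      HasDerivAt (fun y => ∫ z in t..y, f z) (f r) r := by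
    intro f hf r hr
    have hI : IntervalIntegrable f volume t r :=
      (hf.mono (by rw [uIcc_of_le hr.1.le]; exact Icc_subset_Icc_right hr.2.le)).intervalIntegrable
    refine intervalIntegral.integral_hasDerivAt_right hI ?_
      (hf.continuousAt (Icc_mem_nhds hr.1 hr.2))
    exact (hf.mono Ioo_subset_Icc_self).stronglyMeasurableAtFilter isOpen_Ioo r hr
  have hcont : ∀ f : ℝ → ℝ, ContinuousOn f (Icc t T) →
      ContinuousOn (fun y => ∫ z in t..y, f z) (Icc t T) := by
    intro f hf
    have := intervalIntegral.continuousOn_primitive_interval (a := t) (b := T) (f := f)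
      (μ := volume) (by rw [uIcc_of_le htT]; exact hf.integrableOn_Icc)
    rwa [uIcc_of_le htT] at this
  -- By the hypothesis on `φ`, `H'(r) ≤ (exp(-C(r - t)) - 1) a(r) ≤ 0`; the claim is `H s ≤ H t =
  -- 0`.
  set H : ℝ → ℝ := fun y => Real.exp (-(C * (y - t))) * (∫ z in t..y, φ z) - ∫ z in t..y, a z
    with hH
  have hE : Continuous fun y : ℝ => Real.exp (-(C * (y - t))) := by fun_prop
  have hHc : ContinuousOn H (Icc t T) :=
    (hE.continuousOn.mul (hcont φ hφ)).sub (hcont a ha)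
  have hHd : ∀ r ∈ Ioo t T, HasDerivAt H
      ((-C * Real.exp (-(C * (r - t)))) * (∫ z in t..r, φ z)
        + Real.exp (-(C * (r - t))) * φ r - a r) r := by
    intro r hr
    have he : HasDerivAt (fun y : ℝ => Real.exp (-(C * (y - t))))
        (-C * Real.exp (-(C * (r - t)))) r := by
      have h1 : HasDerivAt (fun y : ℝ => -(C * (y - t))) (-C) r := by
        simpa using (((hasDerivAt_id r).sub_const t).const_mul C).fun_neg
      simpa [mul_comm] using h1.exp
    exact (he.mul (hder φ hφ r hr)).sub (hder a ha r hr)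
  have hanti : AntitoneOn H (Icc t T) := by
    refine antitoneOn_of_deriv_nonpos (convex_Icc t T) hHc ?_ ?_
    · rw [interior_Icc]
      exact fun r hr => (hHd r hr).differentiableAt.differentiableWithinAt
    · rw [interior_Icc]
      intro r hr
      rw [(hHd r hr).deriv]
      have hr' := Ioo_subset_Icc_self hr
      have h1 := h r hr'
      have h2 : Real.exp (-(C * (r - t))) ≤ 1 := by
        rw [Real.exp_le_one_iff]
        have := mul_nonneg hC (sub_nonneg.2 hr.1.le)
        linarith
      have h3 := Real.exp_pos (-(C * (r - t)))
      have h4 := ha0 r hr'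
      nlinarith [mul_le_mul_of_nonneg_left h1 h3.le, mul_le_mul_of_nonneg_right h2 h4]
  have h5 : H s ≤ H t := hanti (left_mem_Icc.2 htT) hs hs.1
  simp only [hH, intervalIntegral.integral_same, mul_zero, sub_zero] at h5
  have h6 : Real.exp (C * (s - t)) * Real.exp (-(C * (s - t))) = 1 := by
    rw [← Real.exp_add]; simp
  have h7 := Real.exp_pos (C * (s - t))
  calc ∫ r in t..s, φ r
      = Real.exp (C * (s - t)) * (Real.exp (-(C * (s - t))) * ∫ r in t..s, φ r) := by
        rw [← mul_assoc, h6, one_mul]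
    _ ≤ _ := mul_le_mul_of_nonneg_left (by linarith) h7.le

end Gronwall

/-! ### Carathéodory equations with a square integrable Lipschitz bound. -/

section Caratheodory

variable {E : Type*} [NormedAddCommGroup E] [NormedSpace ℝ E] {t T : ℝ}

lemma setIntegral_Icc_mono_of_nonneg {g : ℝ → ℝ} (hg : IntegrableOn g (Icc t T))
    (h0 : ∀ r ∈ Icc t T, 0 ≤ g r) {s : ℝ} (hs : s ∈ Icc t T) :
    ∫ r in t..s, g r ≤ ∫ r in Icc t T, g r := by
  rw [intervalIntegral.integral_of_le hs.1]
  refine setIntegral_mono_set hg ?_ ?_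
  · exact (ae_restrict_iff' measurableSet_Icc).2 (ae_of_all _ h0)
  · exact (Ioc_subset_Icc_self.trans (Icc_subset_Icc_right hs.2)).eventuallyLE

/-- Squaring and Cauchy–Schwarz trade the time-dependent factor `κ` for the constant `∫ κ²`; the
estimates on trajectories below therefore concern squared norms. -/
lemma sq_norm_intervalIntegral_le {F : ℝ → E} {κ ψ : ℝ → ℝ}
    (hκ : MemLp κ 2 (volume.restrict (Icc t T))) (hψ : MemLp ψ 2 (volume.restrict (Icc t T)))
    (h : ∀ r ∈ Icc t T, ‖F r‖ ≤ κ r * ψ r) {s : ℝ} (hs : s ∈ Icc t T) :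
    ‖∫ r in t..s, F r‖ ^ 2 ≤ (∫ r in Icc t T, κ r ^ 2) * ∫ r in t..s, ψ r ^ 2 := by
  have hsub : Ioc t s ⊆ Icc t T := Ioc_subset_Icc_self.trans (Icc_subset_Icc_right hs.2)
  have hle : volume.restrict (Ioc t s) ≤ volume.restrict (Icc t T) :=
    Measure.restrict_mono hsub le_rfl
  have hκ' := hκ.mono_measure hle
  have hψ' := hψ.mono_measure hle
  have h1 : ‖∫ r in t..s, F r‖ ≤ ∫ r in Ioc t s, κ r * ψ r := by
    rw [intervalIntegral.integral_of_le hs.1]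
    refine norm_integral_le_of_norm_le (g := fun r => κ r * ψ r) (hκ'.integrable_mul hψ') ?_
    exact (ae_restrict_iff' measurableSet_Ioc).2 (ae_of_all _ fun r hr => h r (hsub hr))
  have h2 := integral_mul_sq_le hκ' hψ'
  have h3 : ∫ r in Ioc t s, κ r ^ 2 ≤ ∫ r in Icc t T, κ r ^ 2 := by
    rw [← intervalIntegral.integral_of_le hs.1]
    exact setIntegral_Icc_mono_of_nonneg hκ.integrable_sq (fun _ _ => sq_nonneg _) hs
  rw [intervalIntegral.integral_of_le hs.1 (f := fun r => ψ r ^ 2)]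
  refine (pow_le_pow_left₀ (norm_nonneg _) h1 2).trans (h2.trans ?_)
  exact mul_le_mul_of_nonneg_right h3 (by positivity)

lemma ContinuousOn.memLp_Icc {F : Type*} [NormedAddCommGroup F] {X : ℝ → F}
    (hX : ContinuousOn X (Icc t T)) (p : ENNReal) : MemLp X p (volume.restrict (Icc t T)) := by
  obtain ⟨C, hC⟩ := isCompact_Icc.exists_bound_of_continuousOn hX
  exact MemLp.of_bound (hX.aestronglyMeasurable_of_isCompact isCompact_Icc measurableSet_Icc) C
    ((ae_restrict_iff' measurableSet_Icc).2 (ae_of_all _ hC))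

lemma continuousOn_primitive_Icc {F : ℝ → E} (hF : IntegrableOn F (Icc t T)) :
    ContinuousOn (fun s => ∫ r in t..s, F r) (Icc t T) := by
  rcases le_or_gt t T with h | h
  · have := intervalIntegral.continuousOn_primitive_interval (a := t) (b := T) (f := F)
      (μ := volume) (by rwa [uIcc_of_le h])
    rwa [uIcc_of_le h] at this
  · rw [Icc_eq_empty h.not_ge]
    exact continuousOn_empty _

lemma IntegrableOn.intervalIntegrable_Icc {E' : Type*} [NormedAddCommGroup E'] {F : ℝ → E'}
    (hF : IntegrableOn F (Icc t T)) {s : ℝ} (hs : s ∈ Icc t T) : IntervalIntegrable F volume t s :=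
  (intervalIntegrable_iff_integrableOn_Icc_of_le hs.1).2
    (hF.mono_set (Icc_subset_Icc_right hs.2))

variable {f : ℝ → E → E} {κ : ℝ → ℝ}

/-- The difference of two Picard images, for a field with a square integrable Lipschitz bound. -/
lemma sq_norm_integral_sub_le (hκ : MemLp κ 2 (volume.restrict (Icc t T)))
    (hf : ∀ X : ℝ → E, ContinuousOn X (Icc t T) → IntegrableOn (fun r => f r (X r)) (Icc t T))
    (hl : ∀ r ∈ Icc t T, ∀ x y, ‖f r x - f r y‖ ≤ κ r * ‖x - y‖) {X Y : ℝ → E}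
    (hX : ContinuousOn X (Icc t T)) (hY : ContinuousOn Y (Icc t T)) {s : ℝ} (hs : s ∈ Icc t T) :
    ‖(∫ r in t..s, f r (X r)) - ∫ r in t..s, f r (Y r)‖ ^ 2 ≤
      (∫ r in Icc t T, κ r ^ 2) * ∫ r in t..s, ‖X r - Y r‖ ^ 2 := by
  rw [← intervalIntegral.integral_sub (IntegrableOn.intervalIntegrable_Icc (hf X hX) hs)
    (IntegrableOn.intervalIntegrable_Icc (hf Y hY) hs)]
  exact sq_norm_intervalIntegral_le hκ ((hX.sub hY).norm.memLp_Icc 2)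
    (fun r hr => hl r hr _ _) hs

/-- Uniqueness of Carathéodory solutions. -/
lemma eqOn_of_eq_integral (hκ : MemLp κ 2 (volume.restrict (Icc t T)))
    (hf : ∀ X : ℝ → E, ContinuousOn X (Icc t T) → IntegrableOn (fun r => f r (X r)) (Icc t T))
    (hl : ∀ r ∈ Icc t T, ∀ x y, ‖f r x - f r y‖ ≤ κ r * ‖x - y‖) {X Y : ℝ → E} {x : E}
    (hX : ContinuousOn X (Icc t T)) (hY : ContinuousOn Y (Icc t T))
    (hXe : ∀ s ∈ Icc t T, X s = x + ∫ r in t..s, f r (X r))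
    (hYe : ∀ s ∈ Icc t T, Y s = x + ∫ r in t..s, f r (Y r)) : EqOn X Y (Icc t T) := by
  have h1 : ∀ s ∈ Icc t T, ‖X s - Y s‖ ^ 2 ≤
      0 + (∫ r in Icc t T, κ r ^ 2) * ∫ r in t..s, ‖X r - Y r‖ ^ 2 := by
    intro s hs
    rw [zero_add, hXe s hs, hYe s hs, add_sub_add_left_eq_sub]
    exact sq_norm_integral_sub_le hκ hf hl hX hY hs
  intro s hs
  have hC : 0 ≤ ∫ r in Icc t T, κ r ^ 2 := by positivity
  have h2 := integral_le_of_le_add_mul_integral (a := fun _ => 0) hC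
    ((hX.sub hY).norm.pow 2) continuousOn_const (fun _ _ => le_rfl) h1 hs
  simp only [intervalIntegral.integral_zero, mul_zero] at h2
  have h3 := h1 s hs
  have h4 : ‖X s - Y s‖ ^ 2 ≤ 0 := by
    have := mul_le_mul_of_nonneg_left h2 hC
    simp only [Pi.pow_apply, Pi.sub_apply] at this
    linarith
  have h5 : ‖X s - Y s‖ = 0 := by
    have := sq_nonneg ‖X s - Y s‖
    exact pow_eq_zero_iff two_ne_zero |>.1 (le_antisymm h4 this)
  exact sub_eq_zero.1 (norm_eq_zero.1 h5)

lemma integral_pow_div_factorial (C : ℝ) (j : ℕ) (t s : ℝ) :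
    C * ∫ r in t..s, (C * (r - t)) ^ j / j.factorial
      = (C * (s - t)) ^ (j + 1) / (j + 1).factorial := by
  have h : ∫ r in t..s, (r - t) ^ j = (s - t) ^ (j + 1) / (j + 1) := by
    rw [intervalIntegral.integral_comp_sub_right (fun r => r ^ j) t, integral_pow]
    simp
  simp only [mul_pow, mul_div_assoc]
  rw [intervalIntegral.integral_const_mul, intervalIntegral.integral_div, h, Nat.factorial_succ]
  have h1 : (j : ℝ) + 1 ≠ 0 := by positivity
  have h2 : (j.factorial : ℝ) ≠ 0 := by positivity
  push_cast
  field_simp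
  ring

/-- Existence of Carathéodory solutions, for a field with a square integrable Lipschitz bound. -/
lemma exists_eq_integral [CompleteSpace E] (htT : t ≤ T)
    (hκ : MemLp κ 2 (volume.restrict (Icc t T)))
    (hf : ∀ X : ℝ → E, ContinuousOn X (Icc t T) → IntegrableOn (fun r => f r (X r)) (Icc t T))
    (hl : ∀ r ∈ Icc t T, ∀ x y, ‖f r x - f r y‖ ≤ κ r * ‖x - y‖) (x : E) :
    ∃ X : ℝ → E, ContinuousOn X (Icc t T) ∧
      ∀ s ∈ Icc t T, X s = x + ∫ r in t..s, f r (X r) := by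
  have hext : ∀ X : C(Icc t T, E), ContinuousOn (IccExtend htT X) (Icc t T) := fun X =>
    X.continuous.Icc_extend'.continuousOn
  -- The Picard map; functions on `[t, T]` are extended by constants so that integrals over `ℝ` make
  -- sense.
  let Φ : C(Icc t T, E) → C(Icc t T, E) := fun X =>
    ⟨fun s => x + ∫ r in t..(s : ℝ), f r (IccExtend htT X r), continuous_const.add
      (continuousOn_iff_continuous_domRestrict.1 (continuousOn_primitive_Icc (hf _ (hext X))))⟩
  have hΦ : ∀ X s, Φ X s = x + ∫ r in t..(s : ℝ), f r (IccExtend htT X r) := fun _ _ => rfl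
  set C := ∫ r in Icc t T, κ r ^ 2 with hCdef
  have hC : 0 ≤ C := by positivity
  have hiter : ∀ (j : ℕ) (X Y : C(Icc t T, E)) (s : Icc t T),
      ‖(Φ^[j] X) s - (Φ^[j] Y) s‖ ^ 2 ≤ (C * (s - t)) ^ j / j.factorial * dist X Y ^ 2 := by
    intro j
    induction j with
    | zero =>
      intro X Y s
      simp only [Function.iterate_zero, id, pow_zero, Nat.factorial_zero, Nat.cast_one, div_one,
        one_mul]
      rw [← dist_eq_norm]
      exact pow_le_pow_left₀ dist_nonneg (ContinuousMap.dist_apply_le_dist s) 2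
    | succ j ih =>
      intro X Y s
      rw [Function.iterate_succ_apply', Function.iterate_succ_apply', hΦ, hΦ,
        add_sub_add_left_eq_sub]
      refine (sq_norm_integral_sub_le hκ hf hl (hext _) (hext _) s.2).trans ?_
      have h1 : ∫ r in t..(s : ℝ),
          ‖IccExtend htT (Φ^[j] X) r - IccExtend htT (Φ^[j] Y) r‖ ^ 2 ≤
          ∫ r in t..(s : ℝ), (C * (r - t)) ^ j / j.factorial * dist X Y ^ 2 := by
        refine intervalIntegral.integral_mono_on s.2.1 ?_ ?_ ?_
        · refine Continuous.intervalIntegrable ?_ _ _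
          exact ((Φ^[j] X).continuous.Icc_extend'.sub (Φ^[j] Y).continuous.Icc_extend').norm.pow 2
        · exact Continuous.intervalIntegrable (by fun_prop) _ _
        · intro r hr
          have hr' : r ∈ Icc t T := ⟨hr.1, hr.2.trans s.2.2⟩
          rw [IccExtend_of_mem _ _ hr', IccExtend_of_mem _ _ hr']
          exact ih X Y ⟨r, hr'⟩
      refine (mul_le_mul_of_nonneg_left h1 hC).trans (le_of_eq ?_)
      rw [intervalIntegral.integral_mul_const, ← mul_assoc, integral_pow_div_factorial]
  -- The factorial wins, so some iterate of `Φ` is a contraction; its fixed point is also fixed by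
  -- `Φ`.
  obtain ⟨j, hj⟩ := ((FloorSemiring.tendsto_pow_div_factorial_atTop (C * (T - t))).eventually
    (gt_mem_nhds one_pos)).exists
  have hq : 0 ≤ (C * (T - t)) ^ j / j.factorial := by
    have := mul_nonneg hC (sub_nonneg.2 htT)
    positivity
  have hcontr : ContractingWith (Real.toNNReal √((C * (T - t)) ^ j / j.factorial)) Φ^[j] := by
    refine ⟨?_, LipschitzWith.of_dist_le_mul fun X Y => ?_⟩
    · rw [Real.toNNReal_lt_one, Real.sqrt_lt' one_pos]
      simpa using hj
    · rw [Real.coe_toNNReal _ (Real.sqrt_nonneg _),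
        ContinuousMap.dist_le (mul_nonneg (Real.sqrt_nonneg _) dist_nonneg)]
      intro s
      rw [dist_eq_norm]
      refine abs_le_of_sq_le_sq' ?_ (by positivity) |>.2
      refine (hiter j X Y s).trans ?_
      rw [mul_pow (√_), Real.sq_sqrt hq]
      have : 0 ≤ C * ((s : ℝ) - t) := mul_nonneg hC (sub_nonneg.2 s.2.1)
      have hsT := s.2.2
      gcongr
  have hfix := hcontr.isFixedPt_fixedPoint_iterate
  set X := hcontr.fixedPoint with hXdef
  refine ⟨IccExtend htT X, hext X, fun s hs => ?_⟩
  rw [IccExtend_of_mem _ _ hs]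
  have h := hΦ X ⟨s, hs⟩
  rwa [hfix.eq] at h

end Caratheodory

/-! ### Well-posedness of the state equation and of the cost. -/

lemma Matrix.aestronglyMeasurable_act {k l : ℕ} {μ : Measure ℝ}
    {M : ℝ → Matrix (Fin k) (Fin l) ℝ} {u : ℝ → Euc l} (hM : AEStronglyMeasurable M μ)
    (hu : AEStronglyMeasurable u μ) : AEStronglyMeasurable (fun r => (M r).act (u r)) μ := by
  have h := hM.prodMk hu
  have h' := Matrix.continuous_act.comp_aestronglyMeasurable h
  exact h'

lemma MeasureTheory.MemLp.act {k l : ℕ} {t T : ℝ} {M : ℝ → Matrix (Fin k) (Fin l) ℝ}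
    {u : ℝ → Euc l} (hM : ContinuousOn M (Icc t T)) (hu : MemLp u 2 (volume.restrict (Icc t T))) :
    MemLp (fun r => (M r).act (u r)) 2 (volume.restrict (Icc t T)) := by
  obtain ⟨C, hC⟩ := isCompact_Icc.exists_bound_of_continuousOn hM
  have hMm : AEStronglyMeasurable M (volume.restrict (Icc t T)) :=
    hM.aestronglyMeasurable_of_isCompact isCompact_Icc measurableSet_Icc
  have hm : AEStronglyMeasurable (fun r => (M r).act (u r)) (volume.restrict (Icc t T)) :=
    Matrix.aestronglyMeasurable_act hMm hu.aestronglyMeasurable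
  have hb : ∀ᵐ r ∂(volume.restrict (Icc t T)), ‖(M r).act (u r)‖ ≤ C * ‖u r‖ := by
    refine (ae_restrict_iff' measurableSet_Icc).2 (ae_of_all _ fun r hr => ?_)
    exact (Matrix.norm_act_le _ _).trans
      (mul_le_mul_of_nonneg_right (hC r hr) (norm_nonneg _))
  exact (hu.norm.const_mul C).mono' hm hb

namespace AQData

variable {n m : ℕ} {D : AQData n m} {t : ℝ} {x : Euc n} {u : ℝ → Euc m} {X Y : ℝ → Euc n}

lemma continuousOn_along {F : Type*} [TopologicalSpace F] {g : ℝ → Euc n → F}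
    (hg : ContinuousOn (fun p : ℝ × Euc n => g p.1 p.2) D.strip) (ht : t ∈ Icc 0 D.T)
    (hX : ContinuousOn X (Icc t D.T)) : ContinuousOn (fun r => g r (X r)) (Icc t D.T) :=
  hg.comp (f := fun r => (r, X r)) (continuousOn_id.prodMk hX) fun _ hr =>
    ⟨⟨ht.1.trans hr.1, hr.2⟩, mem_univ _⟩

lemma H1.memLp_velocity (h1 : D.H1) (ht : t ∈ Icc 0 D.T)
    (hu : MemLp u 2 (volume.restrict (Icc t D.T))) (hX : ContinuousOn X (Icc t D.T)) :
    MemLp (fun r => D.A r (X r) + (D.B r (X r)).act (u r)) 2 (volume.restrict (Icc t D.T)) :=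
  ((continuousOn_along h1.continuous_A ht hX).memLp_Icc 2).add
    (hu.act (continuousOn_along h1.continuous_B ht hX))

lemma H1.integrableOn_velocity (h1 : D.H1) (ht : t ∈ Icc 0 D.T)
    (hu : MemLp u 2 (volume.restrict (Icc t D.T))) (hX : ContinuousOn X (Icc t D.T)) :
    IntegrableOn (fun r => D.A r (X r) + (D.B r (X r)).act (u r)) (Icc t D.T) :=
  (h1.memLp_velocity ht hu hX).integrable (by norm_num)

lemma H1.exists_lipschitz (h1 : D.H1) : ∃ a > (0 : ℝ), ∃ b > (0 : ℝ), ∀ r ∈ Icc 0 D.T,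
    ∀ (y z : Euc n) (w : Euc m), ‖(D.A r y + (D.B r y).act w) - (D.A r z + (D.B r z).act w)‖ ≤
      (a + b * ‖w‖) * ‖y - z‖ := by
  obtain ⟨a, ha, hA⟩ := h1.lipschitz_A
  obtain ⟨b, hb, hB⟩ := h1.lipschitz_B
  refine ⟨a, ha, b, hb, fun r hr y z w => ?_⟩
  rw [add_sub_add_comm, ← Matrix.sub_act]
  refine (norm_add_le _ _).trans ?_
  have h2 := hA r hr y z
  have h3 : ‖(D.B r y - D.B r z).act w‖ ≤ b * ‖y - z‖ * ‖w‖ :=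
    (Matrix.norm_act_le _ _).trans (mul_le_mul_of_nonneg_right (hB r hr y z) (norm_nonneg _))
  linarith

lemma H1.exists_isTrajectory (h1 : D.H1) (ht : t ∈ Icc 0 D.T)
    (hu : MemLp u 2 (volume.restrict (Icc t D.T))) (x : Euc n) :
    ∃ X, D.IsTrajectory t x u X := by
  obtain ⟨a, -, b, -, hl⟩ := h1.exists_lipschitz
  obtain ⟨X, hX, hXe⟩ := exists_eq_integral (E := Euc n)
    (f := fun r y => D.A r y + (D.B r y).act (u r))
    (κ := fun r => a + b * ‖u r‖) ht.2 ((memLp_const a).add (hu.norm.const_mul b))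
    (fun X hX => h1.integrableOn_velocity ht hu hX)
    (fun r hr y z => hl r ⟨ht.1.trans hr.1, hr.2⟩ y z (u r)) x
  exact ⟨X, hX, h1.integrableOn_velocity ht hu hX, hXe⟩

lemma H1.isTrajectory_eqOn (h1 : D.H1) (ht : t ∈ Icc 0 D.T)
    (hu : MemLp u 2 (volume.restrict (Icc t D.T))) (hX : D.IsTrajectory t x u X)
    (hY : D.IsTrajectory t x u Y) : EqOn X Y (Icc t D.T) := by
  obtain ⟨a, -, b, -, hl⟩ := h1.exists_lipschitz
  exact eqOn_of_eq_integral (E := Euc n) (f := fun r y => D.A r y + (D.B r y).act (u r))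
    (κ := fun r => a + b * ‖u r‖) ((memLp_const a).add (hu.norm.const_mul b))
    (fun X hX => h1.integrableOn_velocity ht hu hX)
    (fun r hr y z => hl r ⟨ht.1.trans hr.1, hr.2⟩ y z (u r)) hX.continuousOn hY.continuousOn
    hX.eq_integral hY.eq_integral

lemma H2.integrableOn_runningCost (h2 : D.H2) (ht : t ∈ Icc 0 D.T)
    (hu : MemLp u 2 (volume.restrict (Icc t D.T))) (hX : ContinuousOn X (Icc t D.T)) :
    IntegrableOn (D.runningCost X u) (Icc t D.T) := by
  have hQ : IntegrableOn (fun s => D.Q s (X s)) (Icc t D.T) :=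
    (continuousOn_along h2.continuous_Q ht hX).integrableOn_Icc
  have hS := ((continuousOn_along h2.continuous_S ht hX).memLp_Icc 2).integrable_inner_of_two hu
  have hR := (hu.act (continuousOn_along h2.continuous_R ht hX)).integrable_inner_of_two hu
  exact (hQ.add hS).add (hR.const_mul (1 / 2))

lemma H1.wellPosed (h1 : D.H1) (h2 : D.H2) (ht : t ∈ Icc 0 D.T) (x : Euc n) :
    D.WellPosed t x := by
  intro u hu
  obtain ⟨X, hX⟩ := h1.exists_isTrajectory ht hu.1 x
  exact ⟨X, hX, fun Y hY => h1.isTrajectory_eqOn ht hu.1 hY hX,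
    h2.integrableOn_runningCost ht hu.1 hX.continuousOn⟩

lemma H1.isTrajectory_state (h1 : D.H1) (ht : t ∈ Icc 0 D.T)
    (hu : MemLp u 2 (volume.restrict (Icc t D.T))) (x : Euc n) :
    D.IsTrajectory t x u (D.state t x u) := by
  have h := h1.exists_isTrajectory ht hu x
  rw [state, dif_pos h]
  exact h.choose_spec

lemma J_eq_setIntegral (ht : t ∈ Icc 0 D.T) :
    D.J t x u = (∫ s in Icc t D.T, D.runningCost (D.state t x u) u s)
      + D.G (D.state t x u D.T) := by
  rw [J, intervalIntegral.integral_of_le ht.2, integral_Icc_eq_integral_Ioc]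

end AQData

/-! ### Quadratic forms of coercive symmetric matrices. -/

section Coercive

variable {n m : ℕ}

lemma Matrix.PosSemidef.mul_norm_sq_le_inner_act {R : Matrix (Fin m) (Fin m) ℝ} {ρ : ℝ}
    (h : (R - ρ • (1 : Matrix (Fin m) (Fin m) ℝ)).PosSemidef) (v : Euc m) :
    ρ * ‖v‖ ^ 2 ≤ inner ℝ (R.act v) v := by
  have h1 := (Matrix.isPositive_toEuclideanLin_iff.2 h).re_inner_nonneg_left v
  have h2 : Matrix.toEuclideanLin (R - ρ • (1 : Matrix (Fin m) (Fin m) ℝ)) v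
      = R.act v - ρ • v := by
    rw [map_sub, map_smul]
    simp [Matrix.act]
  rw [h2, inner_sub_left, real_inner_smul_left, real_inner_self_eq_norm_sq] at h1
  simpa using h1

lemma Matrix.PosSemidef.mul_inv_of_sub_smul_one {R : Matrix (Fin m) (Fin m) ℝ} {ρ : ℝ}
    (hρ : 0 < ρ) (h : (R - ρ • (1 : Matrix (Fin m) (Fin m) ℝ)).PosSemidef) : R * R⁻¹ = 1 := by
  have h1 : R.PosDef := by
    have := Matrix.PosDef.posSemidef_add h (Matrix.PosDef.one.smul hρ)
    simpa using this
  exact Matrix.mul_nonsing_inv _ ((Matrix.isUnit_iff_isUnit_det _).1 h1.isUnit)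

lemma Matrix.act_inv_act {R : Matrix (Fin m) (Fin m) ℝ} (h : R * R⁻¹ = 1) (v : Euc m) :
    R.act (R⁻¹.act v) = v := by
  rw [← Matrix.mul_act, h]
  simp [Matrix.act]

lemma Matrix.IsSymm.inner_act_comm {R : Matrix (Fin m) (Fin m) ℝ} (h : R.IsSymm) (v w : Euc m) :
    inner ℝ (R.act v) w = inner ℝ (R.act w) v := by
  rw [Matrix.inner_act_left, h.eq, real_inner_comm]

/-- `|B v|² ≤ ‖B R⁻¹ Bᵀ‖ ⟨R v, v⟩` for a coercive symmetric matrix `R`. -/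
lemma Matrix.norm_act_sq_le {R : Matrix (Fin m) (Fin m) ℝ} (hs : R.IsSymm) (hR : R * R⁻¹ = 1)
    (hpos : ∀ v : Euc m, 0 ≤ inner ℝ (R.act v) v) (B : Matrix (Fin n) (Fin m) ℝ) {L : ℝ}
    (hL : 0 < L) (hB : ‖B * R⁻¹ * B.transpose‖ ≤ L) (v : Euc m) :
    ‖B.act v‖ ^ 2 ≤ L * inner ℝ (R.act v) v := by
  set w := B.act v with hw
  set z := R⁻¹.act (B.transpose.act w) with hz
  have h1 : R.act z = B.transpose.act w := Matrix.act_inv_act hR _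
  have h2 : inner ℝ (R.act z) v = ‖w‖ ^ 2 := by
    rw [h1, real_inner_comm, ← Matrix.inner_act_left, ← hw, real_inner_self_eq_norm_sq]
  have h3 : inner ℝ (R.act z) z ≤ L * ‖w‖ ^ 2 := by
    rw [h1, real_inner_comm, ← Matrix.inner_act_left, hz, ← Matrix.mul_act, ← Matrix.mul_act]
    refine (real_inner_le_norm _ _).trans ?_
    have := (Matrix.norm_act_le (B * R⁻¹ * B.transpose) w).trans
      (mul_le_mul_of_nonneg_right hB (norm_nonneg _))
    nlinarith [norm_nonneg w]
  -- Expanding gives `0 ≤ L²⟨Rv, v⟩ - 2L|w|² + ⟨Rz, z⟩`, and `h3` absorbs the last term into half of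
  -- the middle one.
  have h4 := hpos (L • v - z)
  have h5 : R.act (L • v - z) = L • R.act v - R.act z := by simp [Matrix.act]
  rw [h5, inner_sub_left, inner_sub_right, inner_sub_right, real_inner_smul_left,
    real_inner_smul_left, real_inner_smul_right, real_inner_smul_right, hs.inner_act_comm v z,
    h2] at h4
  have h6 : 0 ≤ L * (L * inner ℝ (R.act v) v - ‖w‖ ^ 2) := by nlinarith
  exact sub_nonneg.1 (nonneg_of_mul_nonneg_right h6 hL)

/-- Completion of the square. -/
lemma Matrix.inner_add_half_inner_act {R : Matrix (Fin m) (Fin m) ℝ} (hs : R.IsSymm)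
    {S p : Euc m} (hp : R.act p = S) (u : Euc m) :
    inner ℝ S u + 1 / 2 * inner ℝ (R.act u) u
      = 1 / 2 * inner ℝ (R.act (u + p)) (u + p) - 1 / 2 * inner ℝ S p := by
  have h1 : R.act (u + p) = R.act u + S := by rw [← hp]; simp [Matrix.act]
  have h2 : inner ℝ (R.act u) p = inner ℝ S u := by rw [hs.inner_act_comm, hp]
  rw [h1, inner_add_left, inner_add_right, inner_add_right, h2]
  ring

end Coercive

/-! ### Bounds on the Lagrangian from below. -/

namespace AQData

variable {n m : ℕ} {D : AQData n m}

/-- The Lagrangian `Q + ⟨S, u⟩ + ½⟨R u, u⟩`. -/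
noncomputable def lagrangian (D : AQData n m) (s : ℝ) (x : Euc n) (u : Euc m) : ℝ :=
  D.Q s x + inner ℝ (D.S s x) u + 1 / 2 * inner ℝ ((D.R s x).act u) u

lemma H1.exists_norm_A_le (h1 : D.H1) :
    ∃ a > (0 : ℝ), ∀ s ∈ Icc 0 D.T, ∀ x : Euc n, ‖D.A s x‖ ≤ a * (1 + ‖x‖) := by
  obtain ⟨LA, hLA, hA⟩ := h1.lipschitz_A
  have hc : ContinuousOn (fun s => D.A s 0) (Icc 0 D.T) :=
    h1.continuous_A.comp (f := fun s => (s, (0 : Euc n)))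
      (continuousOn_id.prodMk continuousOn_const) fun _ hr => ⟨hr, mem_univ _⟩
  obtain ⟨C, hC⟩ := isCompact_Icc.exists_bound_of_continuousOn hc
  refine ⟨|C| + LA, by positivity, fun s hs x => ?_⟩
  have h2 := hA s hs x 0
  have h3 := (hC s hs).trans (le_abs_self C)
  have h4 := norm_sub_norm_le (D.A s x) (D.A s 0)
  rw [sub_zero] at h2
  nlinarith [norm_nonneg x, abs_nonneg C]

/-- The velocity is controlled by the state and by the Lagrangian. -/
lemma H2.exists_velocity_bound (h1 : D.H1) (h2 : D.H2) :
    ∃ c₀ > (0 : ℝ), ∃ c₁ > (0 : ℝ), ∃ c₂ > (0 : ℝ), ∀ s ∈ Icc 0 D.T, ∀ (x : Euc n) (u : Euc m),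
      0 ≤ D.lagrangian s x u + c₀ ∧
      ‖D.A s x + (D.B s x).act u‖ ^ 2 ≤
        c₁ * (1 + ‖x‖ ^ 2) + c₂ * (D.lagrangian s x u + c₀) := by
  obtain ⟨a, ha, hA⟩ := h1.exists_norm_A_le
  obtain ⟨L, hL, Q₀, -, G₀, -, S₀, -, ε, ⟨hε0, hε1⟩, ρ₀, hρ₀, ρ, -, hρ, hb⟩ := h2.bounds
  -- In `c₀`, `L` comes from the lower bound on `(1 - ε)Q - ½⟨S, p⟩` and `L / (1 - ε)` covers the
  -- leftover `εQ`. The factors 4 come from two uses of `(a + b)² ≤ 2a² + 2b²` in `c₁`, and from one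
  -- use together with the ½ of the quadratic form in `c₂`.
  refine ⟨L / (1 - ε) + L, by have := sub_pos.2 hε1; positivity, 4 * (2 * a + L) ^ 2,
    by positivity, 4 * L, by positivity, fun s hs x u => ?_⟩
  obtain ⟨hR, hQS, -, -, -, -, hABS, hBRB⟩ := hb s hs x
  have hinv := hR.mul_inv_of_sub_smul_one (hρ₀.trans_le (hρ x))
  have hpos : ∀ v : Euc m, 0 ≤ inner ℝ ((D.R s x).act v) v := fun v =>
    (mul_nonneg (hρ₀.le.trans (hρ x)) (sq_nonneg _)).trans (hR.mul_norm_sq_le_inner_act v)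
  have hs' := h2.symm_R s hs x
  set p := (D.R s x)⁻¹.act (D.S s x) with hp
  have hRp : (D.R s x).act p = D.S s x := Matrix.act_inv_act hinv _
  have hl : D.lagrangian s x u = D.Q s x
      + (1 / 2 * inner ℝ ((D.R s x).act (u + p)) (u + p) - 1 / 2 * inner ℝ (D.S s x) p) := by
    rw [← Matrix.inner_add_half_inner_act hs' hRp, lagrangian, add_assoc]
  have hSp : 0 ≤ inner ℝ (D.S s x) p := by rw [← hRp]; exact hpos p
  have hK : L / (1 - ε) * (1 - ε) = L := div_mul_cancel₀ _ (sub_pos.2 hε1).ne'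
  have hK0 : 0 < L / (1 - ε) := div_pos hL (sub_pos.2 hε1)
  have hQ : -(L / (1 - ε)) ≤ D.Q s x := by
    by_contra hcon
    have := mul_lt_mul_of_pos_right (not_le.1 hcon) (sub_pos.2 hε1)
    nlinarith
  have hv := hpos (u + p)
  have hlow : 1 / 2 * inner ℝ ((D.R s x).act (u + p)) (u + p)
      ≤ D.lagrangian s x u + (L / (1 - ε) + L) := by
    rw [hl]
    nlinarith
  refine ⟨by linarith, ?_⟩
  have hBv := Matrix.norm_act_sq_le hs' hinv hpos (D.B s x) hL hBRB (u + p)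
  -- Completing the square leaves the drift `A - Bp`, whereas the hypothesis bounds `A + Bp`; the
  -- difference is paid for by the linear growth of `A`.
  have hsplit : D.A s x + (D.B s x).act u
      = ((2 : ℝ) • D.A s x - (D.A s x + (D.B s x).act p)) + (D.B s x).act (u + p) := by
    simp only [two_smul, Matrix.act, map_add]
    abel
  have hdrift : ‖(2 : ℝ) • D.A s x - (D.A s x + (D.B s x).act p)‖
      ≤ (2 * a + L) * (1 + ‖x‖) := by
    refine (norm_sub_le _ _).trans ?_
    rw [norm_smul, Real.norm_eq_abs, abs_two]
    have := hA s hs x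
    linarith
  have hdrift2 := pow_le_pow_left₀ (norm_nonneg _) hdrift 2
  rw [mul_pow] at hdrift2
  have hx : (1 + ‖x‖) ^ 2 ≤ 2 * (1 + ‖x‖ ^ 2) := by nlinarith [sq_nonneg (1 - ‖x‖)]
  have hx2 := mul_le_mul_of_nonneg_left hx (sq_nonneg (2 * a + L))
  have hsq : ‖D.A s x + (D.B s x).act u‖ ^ 2
      ≤ 2 * ‖(2 : ℝ) • D.A s x - (D.A s x + (D.B s x).act p)‖ ^ 2
        + 2 * ‖(D.B s x).act (u + p)‖ ^ 2 := by
    rw [hsplit]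
    refine (pow_le_pow_left₀ (norm_nonneg _) (norm_add_le _ _) 2).trans ?_
    nlinarith [sq_nonneg (‖(2 : ℝ) • D.A s x - (D.A s x + (D.B s x).act p)‖
      - ‖(D.B s x).act (u + p)‖)]
  have hlow2 := mul_le_mul_of_nonneg_left hlow hL.le
  linarith

/-- The Lagrangian is coercive in the control, locally uniformly in the state. -/
lemma H2.exists_coercive (h2 : D.H2) : ∃ ρ₀ > (0 : ℝ), ∀ M : ℝ, ∃ c : ℝ,
    ∀ s ∈ Icc 0 D.T, ∀ (x : Euc n) (u : Euc m), ‖x‖ ≤ M →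
      ρ₀ * ‖u‖ ^ 2 ≤ D.lagrangian s x u + c := by
  obtain ⟨L, hL, Q₀, -, G₀, -, S₀, hS₀, ε, ⟨hε0, hε1⟩, ρ₀, hρ₀, ρ, -, hρ, hb⟩ := h2.bounds
  -- Of the `ρ₀ / 2` provided by the quadratic term, Young's inequality spends half on `⟨S, u⟩`.
  refine ⟨ρ₀ / 4, by positivity, fun M => ⟨L / (1 - ε) + (S₀ * (1 + M)) ^ 2 / ρ₀,
    fun s hs x u hx => ?_⟩⟩
  obtain ⟨hR, hQS, -, -, -, hS, -, -⟩ := hb s hs x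
  have hinv := hR.mul_inv_of_sub_smul_one (hρ₀.trans_le (hρ x))
  have hSp : 0 ≤ inner ℝ (D.S s x) ((D.R s x)⁻¹.act (D.S s x)) := by
    have := hR.mul_norm_sq_le_inner_act ((D.R s x)⁻¹.act (D.S s x))
    rw [Matrix.act_inv_act hinv] at this
    exact (mul_nonneg (hρ₀.le.trans (hρ x)) (sq_nonneg _)).trans this
  have hK : L / (1 - ε) * (1 - ε) = L := div_mul_cancel₀ _ (sub_pos.2 hε1).ne'
  have hQ : -(L / (1 - ε)) ≤ D.Q s x := by
    by_contra hcon
    have := mul_lt_mul_of_pos_right (not_le.1 hcon) (sub_pos.2 hε1)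
    nlinarith
  have hRu : ρ₀ * ‖u‖ ^ 2 ≤ inner ℝ ((D.R s x).act u) u :=
    (mul_le_mul_of_nonneg_right (hρ x) (sq_nonneg _)).trans (hR.mul_norm_sq_le_inner_act u)
  have hSM : ‖D.S s x‖ ≤ S₀ * (1 + M) := hS.trans (by gcongr)
  have hSu : -(S₀ * (1 + M) * ‖u‖) ≤ inner ℝ (D.S s x) u := by
    have h3 := (abs_le.1 (abs_real_inner_le_norm (D.S s x) u)).1
    have h4 := mul_le_mul_of_nonneg_right hSM (norm_nonneg u)
    linarith
  have hyoung : S₀ * (1 + M) * ‖u‖ ≤ ρ₀ / 4 * ‖u‖ ^ 2 + (S₀ * (1 + M)) ^ 2 / ρ₀ := by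
    rw [← sub_nonneg]
    have : ρ₀ / 4 * ‖u‖ ^ 2 + (S₀ * (1 + M)) ^ 2 / ρ₀ - S₀ * (1 + M) * ‖u‖
        = (ρ₀ / 2 * ‖u‖ - S₀ * (1 + M)) ^ 2 / ρ₀ := by
      field_simp
      ring
    rw [this]
    positivity
  rw [lagrangian]
  linarith

end AQData

/-! ### A priori bounds on states and controls. -/

namespace AQData

variable {n m : ℕ} {D : AQData n m} {t : ℝ} {x : Euc n} {u : ℝ → Euc m} {X Y : ℝ → Euc n}

/-- Along trajectories, a bound on the running cost bounds the state. -/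
lemma H2.exists_state_bound (h1 : D.H1) (h2 : D.H2) (ht : t ∈ Icc 0 D.T) (x : Euc n) (K : ℝ) :
    ∃ M : ℝ, ∀ (u : ℝ → Euc m) (X : ℝ → Euc n),
      MemLp u 2 (volume.restrict (Icc t D.T)) → D.IsTrajectory t x u X →
      ∫ s in Icc t D.T, D.runningCost X u s ≤ K → ∀ s ∈ Icc t D.T, ‖X s‖ ≤ M := by
  obtain ⟨c₀, hc₀, c₁, hc₁, c₂, hc₂, hb⟩ := H2.exists_velocity_bound h1 h2
  set τ := D.T - t with hτ
  have hτ0 : 0 ≤ τ := sub_nonneg.2 ht.2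
  have hvol : ∀ c : ℝ, ∫ _ in Icc t D.T, c = τ * c := by
    intro c
    rw [setIntegral_const, Real.volume_real_Icc_of_le ht.2, smul_eq_mul]
  -- `a` and `C` are the constants of `|X s|² ≤ a + C ∫ |X|²`; Grönwall then yields the bound. The
  -- absolute value in `a` makes it nonnegative whatever the sign of `K`.
  set C := 2 * τ * c₁ with hC
  have hC0 : 0 ≤ C := by positivity
  set a := 2 * ‖x‖ ^ 2 + 2 * τ * (c₁ * τ + c₂ * |K + τ * c₀|) with ha
  have ha0 : 0 ≤ a := by positivity
  refine ⟨√(a + C * (Real.exp (C * τ) * (τ * a))), fun u X hu hX hJ s hs => ?_⟩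
  have hIcc : ∀ r ∈ Icc t D.T, r ∈ Icc 0 D.T := fun r hr => ⟨ht.1.trans hr.1, hr.2⟩
  have hXc := hX.continuousOn
  have hV := h1.memLp_velocity ht hu hXc
  set V : ℝ → Euc n := fun r => D.A r (X r) + (D.B r (X r)).act (u r) with hVdef
  have hℓ : IntegrableOn (fun r => D.runningCost X u r + c₀) (Icc t D.T) :=
    (h2.integrableOn_runningCost ht hu hXc).add (integrable_const c₀)
  have hX2 : ContinuousOn (fun r => ‖X r‖ ^ 2) (Icc t D.T) := hXc.norm.pow 2
  have hineq : ∀ s ∈ Icc t D.T, ‖X s‖ ^ 2 ≤ a + C * ∫ r in t..s, ‖X r‖ ^ 2 := by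
    intro s hs
    have hVint : ‖∫ r in t..s, V r‖ ^ 2 ≤ τ * ∫ r in t..s, ‖V r‖ ^ 2 := by
      have := sq_norm_intervalIntegral_le (F := V) (κ := fun _ => 1) (ψ := fun r => ‖V r‖)
        (memLp_const 1) hV.norm (fun r _ => by simp) hs
      simpa [hvol] using this
    have hXs : ‖X s‖ ^ 2 ≤ 2 * ‖x‖ ^ 2 + 2 * ‖∫ r in t..s, V r‖ ^ 2 := by
      rw [hX.eq_integral s hs]
      refine (pow_le_pow_left₀ (norm_nonneg _) (norm_add_le _ _) 2).trans ?_
      nlinarith [sq_nonneg (‖x‖ - ‖∫ r in t..s, V r‖)]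
    have hi1 : IntervalIntegrable (fun r => c₁ * (1 + ‖X r‖ ^ 2)) volume t s :=
      IntegrableOn.intervalIntegrable_Icc
        (continuousOn_const.mul (continuousOn_const.add hX2)).integrableOn_Icc hs
    have hi2 : IntervalIntegrable (fun r => c₂ * (D.runningCost X u r + c₀)) volume t s :=
      IntegrableOn.intervalIntegrable_Icc (hℓ.const_mul c₂) hs
    have hV2 : ∫ r in t..s, ‖V r‖ ^ 2 ≤
        ∫ r in t..s, (c₁ * (1 + ‖X r‖ ^ 2) + c₂ * (D.runningCost X u r + c₀)) := by
      refine intervalIntegral.integral_mono_on hs.1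
        (IntegrableOn.intervalIntegrable_Icc hV.norm.integrable_sq hs) (hi1.add hi2) fun r hr => ?_
      exact (hb r (hIcc r ⟨hr.1, hr.2.trans hs.2⟩) (X r) (u r)).2
    rw [intervalIntegral.integral_add hi1 hi2, intervalIntegral.integral_const_mul,
      intervalIntegral.integral_const_mul, intervalIntegral.integral_add
        (by simp) (IntegrableOn.intervalIntegrable_Icc hX2.integrableOn_Icc hs),
      intervalIntegral.integral_const, smul_eq_mul, mul_one] at hV2
    -- The shifted cost density is nonnegative, so the total cost bounds every partial integral.
    have hcost : ∫ r in t..s, (D.runningCost X u r + c₀) ≤ |K + τ * c₀| := by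
      refine (setIntegral_Icc_mono_of_nonneg hℓ
        (fun r hr => (hb r (hIcc r hr) (X r) (u r)).1) hs).trans ?_
      rw [integral_add (h2.integrableOn_runningCost ht hu hXc) (integrable_const c₀), hvol]
      exact (by linarith : _ ≤ K + τ * c₀).trans (le_abs_self _)
    have hsτ : s - t ≤ τ := sub_le_sub_right hs.2 t
    have hV3 : ∫ r in t..s, ‖V r‖ ^ 2 ≤
        c₁ * τ + c₂ * |K + τ * c₀| + c₁ * ∫ r in t..s, ‖X r‖ ^ 2 := by
      have e1 := mul_le_mul_of_nonneg_left hsτ hc₁.le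
      have e2 := mul_le_mul_of_nonneg_left hcost hc₂.le
      linarith
    have e3 := mul_le_mul_of_nonneg_left hV3 hτ0
    calc ‖X s‖ ^ 2 ≤ 2 * ‖x‖ ^ 2 + 2 * (τ * ∫ r in t..s, ‖V r‖ ^ 2) := by linarith
      _ ≤ 2 * ‖x‖ ^ 2 + 2 * (τ * (c₁ * τ + c₂ * |K + τ * c₀|
          + c₁ * ∫ r in t..s, ‖X r‖ ^ 2)) := by linarith
      _ = _ := by rw [ha, hC]; ring
  refine Real.le_sqrt_of_sq_le ((hineq s hs).trans ?_)
  have hG := integral_le_of_le_add_mul_integral hC0 hX2 continuousOn_const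
    (fun _ _ => ha0) hineq hs
  rw [intervalIntegral.integral_const, smul_eq_mul] at hG
  have hsτ : s - t ≤ τ := sub_le_sub_right hs.2 t
  have hst : 0 ≤ s - t := sub_nonneg.2 hs.1
  have hexp : Real.exp (C * (s - t)) * ((s - t) * a) ≤ Real.exp (C * τ) * (τ * a) := by
    gcongr
  have := mul_le_mul_of_nonneg_left (hG.trans hexp) hC0
  linarith

/-- Along bounded trajectories, a bound on the running cost bounds the control in `L²`. -/
lemma H2.exists_control_bound (h2 : D.H2) (ht : t ∈ Icc 0 D.T) (K M : ℝ) :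
    ∃ N : ℝ, ∀ (u : ℝ → Euc m) (X : ℝ → Euc n),
      MemLp u 2 (volume.restrict (Icc t D.T)) → ContinuousOn X (Icc t D.T) →
      ∫ s in Icc t D.T, D.runningCost X u s ≤ K → (∀ s ∈ Icc t D.T, ‖X s‖ ≤ M) →
      ∫ s in Icc t D.T, ‖u s‖ ^ 2 ≤ N := by
  obtain ⟨ρ₀, hρ₀, h⟩ := h2.exists_coercive
  obtain ⟨c, hc⟩ := h M
  refine ⟨(K + (D.T - t) * c) / ρ₀, fun u X hu hX hJ hM => ?_⟩
  rw [le_div_iff₀' hρ₀, ← integral_const_mul]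
  have hℓ := h2.integrableOn_runningCost ht hu hX
  have h3 : ∫ s in Icc t D.T, ρ₀ * ‖u s‖ ^ 2
      ≤ ∫ s in Icc t D.T, (D.runningCost X u s + c) := by
    refine setIntegral_mono_on (hu.norm.integrable_sq.const_mul ρ₀)
      (hℓ.add (integrable_const c)) measurableSet_Icc fun s hs => ?_
    exact hc s ⟨ht.1.trans hs.1, hs.2⟩ (X s) (u s) (hM s hs)
  rw [integral_add hℓ (integrable_const c), setIntegral_const, Real.volume_real_Icc_of_le ht.2,
    smul_eq_mul] at h3
  linarith

end AQData

/-! ### Weak continuity of trajectories in the control. -/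

namespace AQData

variable {n m : ℕ} {D : AQData n m} {t : ℝ} {x : Euc n}

/-- The primitive of `B(·, X) (u k - v)` tends to zero if `u k` tends weakly to `v`. -/
lemma tendsto_integral_act_sub {M : ℝ → Matrix (Fin n) (Fin m) ℝ} {T : ℝ}
    (hM : ContinuousOn M (Icc t T)) {u : ℕ → ℝ → Euc m} {v : ℝ → Euc m}
    (hu : ∀ k, MemLp (u k) 2 (volume.restrict (Icc t T)))
    (hv : MemLp v 2 (volume.restrict (Icc t T)))
    (huv : WeakL2Tendsto (volume.restrict (Icc t T)) u v) {s : ℝ} (hs : s ∈ Icc t T) :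
    Tendsto (fun k => ∫ r in t..s, (M r).act (u k r - v r)) atTop (𝓝 0) := by
  have hsub : Ioc t s ⊆ Icc t T := Ioc_subset_Icc_self.trans (Icc_subset_Icc_right hs.2)
  have hMt : ContinuousOn (fun r => (M r).transpose) (Icc t T) :=
    continuous_id.matrix_transpose.comp_continuousOn hM
  have hint : ∀ k, Integrable (fun r => (M r).act (u k r - v r)) (volume.restrict (Ioc t s)) :=
    fun k => (((hu k).sub hv).act hM).integrable (by norm_num) |>.mono_measure
      (Measure.restrict_mono hsub le_rfl)
  have hinner : ∀ e : Euc n, Tendsto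
      (fun k => inner ℝ e (∫ r in t..s, (M r).act (u k r - v r))) atTop (𝓝 0) := by
    intro e
    -- The component along `e` is the pairing of `u k - v` with this fixed `L²` function; in finite
    -- dimension components suffice.
    have hg : MemLp ((Ioc t s).indicator fun r => (M r).transpose.act e) 2
        (volume.restrict (Icc t T)) :=
      ((memLp_const e).act hMt).indicator measurableSet_Ioc
    have h := (huv _ hg).sub_const
      (∫ r in Icc t T, inner ℝ ((Ioc t s).indicator (fun r => (M r).transpose.act e) r) (v r))
    rw [sub_self] at h
    refine h.congr fun k => ?_
    rw [← integral_sub (hg.integrable_inner_of_two (hu k)) (hg.integrable_inner_of_two hv),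
      intervalIntegral.integral_of_le hs.1, ← integral_inner (hint k)]
    have hind : ∀ r, inner ℝ ((Ioc t s).indicator (fun r => (M r).transpose.act e) r) (u k r)
        - inner ℝ ((Ioc t s).indicator (fun r => (M r).transpose.act e) r) (v r)
        = (Ioc t s).indicator (fun r => inner ℝ e ((M r).act (u k r - v r))) r := by
      intro r
      rw [← inner_sub_right]
      by_cases hr : r ∈ Ioc t s
      · rw [indicator_of_mem hr, indicator_of_mem hr, Matrix.inner_act_left,
          Matrix.transpose_transpose]
      · rw [indicator_of_notMem hr, indicator_of_notMem hr, inner_zero_left]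
    simp_rw [hind]
    rw [integral_indicator measurableSet_Ioc, Measure.restrict_restrict measurableSet_Ioc,
      inter_eq_left.2 hsub]
  have hcoord : Tendsto (fun k => (∫ r in t..s, (M r).act (u k r - v r)).ofLp) atTop
      (𝓝 (0 : Euc n).ofLp) := by
    rw [tendsto_pi_nhds]
    intro i
    refine (hinner (EuclideanSpace.single i 1)).congr fun k => ?_
    simp [EuclideanSpace.inner_single_left]
  have h := ((PiLp.continuous_toLp 2 (fun _ : Fin n => ℝ)).tendsto _).comp hcoord
  exact h

/-- Trajectories depend continuously on the control, for the weak topology on bounded sets. -/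
lemma H1.tendsto_trajectory (h1 : D.H1) (ht : t ∈ Icc 0 D.T) {u : ℕ → ℝ → Euc m}
    {v : ℝ → Euc m} {X : ℕ → ℝ → Euc n} {Y : ℝ → Euc n}
    (hu : ∀ k, MemLp (u k) 2 (volume.restrict (Icc t D.T)))
    (hv : MemLp v 2 (volume.restrict (Icc t D.T)))
    (huv : WeakL2Tendsto (volume.restrict (Icc t D.T)) u v) {N : ℝ}
    (hN : ∀ k, ∫ s in Icc t D.T, ‖u k s‖ ^ 2 ≤ N)
    (hX : ∀ k, D.IsTrajectory t x (u k) (X k)) (hY : D.IsTrajectory t x v Y) {s : ℝ}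
    (hs : s ∈ Icc t D.T) : Tendsto (fun k => X k s) atTop (𝓝 (Y s)) := by
  obtain ⟨a, ha, b, hb, hl⟩ := h1.exists_lipschitz
  have hYc := hY.continuousOn
  have hB := continuousOn_along h1.continuous_B ht hYc
  set w : ℕ → ℝ → Euc n := fun k s => ∫ r in t..s, (D.B r (Y r)).act (u k r - v r) with hw
  have hw0 : ∀ s ∈ Icc t D.T, Tendsto (fun k => w k s) atTop (𝓝 0) := fun s hs =>
    tendsto_integral_act_sub hB hu hv huv hs
  have hwint : ∀ k, IntegrableOn (fun r => (D.B r (Y r)).act (u k r - v r)) (Icc t D.T) :=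
    fun k => (((hu k).sub hv).act hB).integrable (by norm_num)
  have hwc : ∀ k, ContinuousOn (w k) (Icc t D.T) := fun k => continuousOn_primitive_Icc (hwint k)
  -- A bound independent of `k`, used as the dominating constant for `∫ ‖w k‖²`.
  have hwb : ∃ W : ℝ, ∀ k, ∀ s ∈ Icc t D.T, ‖w k s‖ ^ 2 ≤ W := by
    refine ⟨(∫ r in Icc t D.T, ‖D.B r (Y r)‖ ^ 2) *
      (2 * N + 2 * ∫ r in Icc t D.T, ‖v r‖ ^ 2), fun k s hs => ?_⟩
    have hd := ((hu k).sub hv).norm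
    refine (sq_norm_intervalIntegral_le (hB.norm.memLp_Icc 2) hd
      (fun r _ => Matrix.norm_act_le _ _) hs).trans
      (mul_le_mul_of_nonneg_left ?_ (by positivity))
    refine (setIntegral_Icc_mono_of_nonneg hd.integrable_sq (fun _ _ => sq_nonneg _) hs).trans ?_
    have h3 : ∫ r in Icc t D.T, ‖(u k - v) r‖ ^ 2
        ≤ ∫ r in Icc t D.T, (2 * ‖u k r‖ ^ 2 + 2 * ‖v r‖ ^ 2) := by
      refine integral_mono hd.integrable_sq (((hu k).norm.integrable_sq.const_mul 2).add
        (hv.norm.integrable_sq.const_mul 2)) fun r => ?_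
      refine (pow_le_pow_left₀ (norm_nonneg _) (norm_sub_le _ _) 2).trans ?_
      nlinarith [sq_nonneg (‖u k r‖ - ‖v r‖)]
    rw [integral_add ((hu k).norm.integrable_sq.const_mul 2)
      (hv.norm.integrable_sq.const_mul 2), integral_const_mul, integral_const_mul] at h3
    have := hN k
    linarith
  obtain ⟨W, hW⟩ := hwb
  set K := 2 * (D.T - t) * a ^ 2 + 2 * b ^ 2 * N with hK
  have hκ : ∀ k, MemLp (fun r => a + b * ‖u k r‖) 2 (volume.restrict (Icc t D.T)) := fun k =>
    (memLp_const a).add ((hu k).norm.const_mul b)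
  have hκK : ∀ k, ∫ r in Icc t D.T, (a + b * ‖u k r‖) ^ 2 ≤ K := by
    intro k
    have h3 : ∫ r in Icc t D.T, (a + b * ‖u k r‖) ^ 2
        ≤ ∫ r in Icc t D.T, (2 * a ^ 2 + 2 * b ^ 2 * ‖u k r‖ ^ 2) := by
      refine integral_mono (hκ k).integrable_sq ((integrable_const _).add
        ((hu k).norm.integrable_sq.const_mul _)) fun r => ?_
      simp only
      nlinarith [sq_nonneg (a - b * ‖u k r‖)]
    rw [integral_add (integrable_const _) ((hu k).norm.integrable_sq.const_mul _),
      integral_const_mul (2 * b ^ 2), setIntegral_const, Real.volume_real_Icc_of_le ht.2, smul_eq_mul] at h3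
    have := mul_le_mul_of_nonneg_left (hN k) (by positivity : 0 ≤ 2 * b ^ 2)
    linarith
  have hK0 : 0 ≤ K := (by positivity : 0 ≤ ∫ r in Icc t D.T, (a + b * ‖u 0 r‖) ^ 2).trans (hκK 0)
  have hK2 : 0 ≤ 2 * K := mul_nonneg zero_le_two hK0
  have hdc : ∀ k, ContinuousOn (fun r => ‖X k r - Y r‖ ^ 2) (Icc t D.T) := fun k =>
    ((hX k).continuousOn.sub hYc).norm.pow 2
  have hineq : ∀ k, ∀ s ∈ Icc t D.T, ‖X k s - Y s‖ ^ 2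
      ≤ 2 * ‖w k s‖ ^ 2 + 2 * K * ∫ r in t..s, ‖X k r - Y r‖ ^ 2 := by
    intro k s hs
    have hvel := fun Z hZ => h1.integrableOn_velocity ht (hu k) (X := Z) hZ
    have hdiff := sq_norm_integral_sub_le (E := Euc n)
      (f := fun r y => D.A r y + (D.B r y).act (u k r)) (hκ k) hvel
      (fun r hr y z => hl r ⟨ht.1.trans hr.1, hr.2⟩ y z (u k r)) (hX k).continuousOn hYc hs
    -- Inserting the velocity of `Y` under the control `u k` separates the weak perturbation `w k`
    -- from a Lipschitz term in `X k - Y`.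
    have hsplit : X k s - Y s = w k s + ((∫ r in t..s, (D.A r (X k r) + (D.B r (X k r)).act (u k r)))
        - ∫ r in t..s, (D.A r (Y r) + (D.B r (Y r)).act (u k r))) := by
      have h3 : ∫ r in t..s, (D.A r (Y r) + (D.B r (Y r)).act (u k r))
          = w k s + ∫ r in t..s, (D.A r (Y r) + (D.B r (Y r)).act (v r)) := by
        rw [hw, ← intervalIntegral.integral_add
          (IntegrableOn.intervalIntegrable_Icc (hwint k) hs)
          (IntegrableOn.intervalIntegrable_Icc hY.integrable hs)]
        refine intervalIntegral.integral_congr fun r _ => ?_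
        simp only [Matrix.act, map_sub]
        abel
      rw [(hX k).eq_integral s hs, hY.eq_integral s hs, h3]
      abel
    have hpos : 0 ≤ ∫ r in t..s, ‖X k r - Y r‖ ^ 2 :=
      intervalIntegral.integral_nonneg hs.1 fun _ _ => sq_nonneg _
    have hmul := mul_le_mul_of_nonneg_right (hκK k) hpos
    rw [hsplit]
    refine (pow_le_pow_left₀ (norm_nonneg _) (norm_add_le _ _) 2).trans ?_
    nlinarith [sq_nonneg (‖w k s‖ - ‖(∫ r in t..s, (D.A r (X k r) + (D.B r (X k r)).act (u k r)))
        - ∫ r in t..s, (D.A r (Y r) + (D.B r (Y r)).act (u k r))‖)]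
  have hwI : Tendsto (fun k => ∫ r in t..s, 2 * ‖w k r‖ ^ 2) atTop (𝓝 0) := by
    have hsub : Ioc t s ⊆ Icc t D.T := Ioc_subset_Icc_self.trans (Icc_subset_Icc_right hs.2)
    have h3 := tendsto_integral_of_dominated_convergence (μ := volume.restrict (Ioc t s))
      (F := fun k r => 2 * ‖w k r‖ ^ 2) (f := fun _ => 0) (fun _ => 2 * W) (fun k => ?_)
      (integrable_const _) (fun k => ?_) ?_
    · simpa [intervalIntegral.integral_of_le hs.1] using h3
    · exact ((continuousOn_const.mul ((hwc k).norm.pow 2)).mono hsub).aestronglyMeasurable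
        measurableSet_Ioc
    · refine (ae_restrict_iff' measurableSet_Ioc).2 (ae_of_all _ fun r hr => ?_)
      rw [Real.norm_of_nonneg (by positivity)]
      linarith [hW k r (hsub hr)]
    · refine (ae_restrict_iff' measurableSet_Ioc).2 (ae_of_all _ fun r hr => ?_)
      simpa using ((hw0 r (hsub hr)).norm.pow 2).const_mul 2
  have hbound : Tendsto (fun k => 2 * ‖w k s‖ ^ 2
      + 2 * K * (Real.exp (2 * K * (s - t)) * ∫ r in t..s, 2 * ‖w k r‖ ^ 2)) atTop (𝓝 0) := by
    simpa using (((hw0 s hs).norm.pow 2).const_mul 2).add ((hwI.const_mul _).const_mul (2 * K))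
  have hsq : Tendsto (fun k => ‖X k s - Y s‖ ^ 2) atTop (𝓝 0) := by
    refine squeeze_zero (fun _ => sq_nonneg _) (fun k => ?_) hbound
    refine (hineq k s hs).trans (add_le_add_right (mul_le_mul_of_nonneg_left ?_ hK2) _)
    exact integral_le_of_le_add_mul_integral hK2 (hdc k)
      (continuousOn_const.mul ((hwc k).norm.pow 2)) (fun _ _ => mul_nonneg zero_le_two (sq_nonneg _)) (hineq k) hs
  rw [tendsto_iff_norm_sub_tendsto_zero]
  simpa [Real.sqrt_sq (norm_nonneg _)] using hsq.sqrt

end AQData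

/-! ### Lower semicontinuity of the cost and the direct method. -/

namespace AQData

variable {n m : ℕ} {D : AQData n m} {t : ℝ} {x : Euc n}

lemma exists_bound_of_continuousOn_strip {F : Type*} [SeminormedAddCommGroup F]
    {g : ℝ → Euc n → F} (hg : ContinuousOn (fun p : ℝ × Euc n => g p.1 p.2) D.strip) (M : ℝ) :
    ∃ C : ℝ, ∀ s ∈ Icc 0 D.T, ∀ y : Euc n, ‖y‖ ≤ M → ‖g s y‖ ≤ C := by
  have hc : IsCompact (Icc 0 D.T ×ˢ Metric.closedBall (0 : Euc n) M) :=
    isCompact_Icc.prod (isCompact_closedBall _ _)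
  obtain ⟨C, hC⟩ := hc.exists_bound_of_continuousOn
    (hg.mono (prod_mono_right (subset_univ _)))
  exact ⟨C, fun s hs y hy => hC (s, y) ⟨hs, by simpa using hy⟩⟩

lemma tendsto_along {F : Type*} [TopologicalSpace F] {g : ℝ → Euc n → F}
    (hg : ContinuousOn (fun p : ℝ × Euc n => g p.1 p.2) D.strip) {s : ℝ} (hs : s ∈ Icc 0 D.T)
    {y : ℕ → Euc n} {z : Euc n} (hy : Tendsto y atTop (𝓝 z)) :
    Tendsto (fun k => g s (y k)) atTop (𝓝 (g s z)) := by
  have h1 : Tendsto (fun k => (s, y k)) atTop (𝓝[D.strip] (s, z)) :=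
    tendsto_nhdsWithin_iff.2 ⟨tendsto_const_nhds.prodMk_nhds hy,
      Eventually.of_forall fun _ => ⟨hs, mem_univ _⟩⟩
  exact (hg (s, z) ⟨hs, mem_univ _⟩).tendsto.comp h1

/-- Tangent inequality for the convex quadratic form of `R`. -/
lemma inner_act_tangent_le {R : Matrix (Fin m) (Fin m) ℝ} (hs : R.IsSymm)
    (hpos : ∀ v : Euc m, 0 ≤ inner ℝ (R.act v) v) (u v : Euc m) :
    inner ℝ (R.act v) u - 1 / 2 * inner ℝ (R.act v) v ≤ 1 / 2 * inner ℝ (R.act u) u := by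
  have h1 := hpos (u - v)
  have h2 : R.act (u - v) = R.act u - R.act v := by simp [Matrix.act]
  rw [h2, inner_sub_left, inner_sub_right, inner_sub_right, hs.inner_act_comm u v] at h1
  linarith

/-- The integrated running cost is sequentially lower semicontinuous: pointwise in the bounded
states and weakly in the bounded controls. -/
lemma H2.integral_runningCost_le (h2 : D.H2) (ht : t ∈ Icc 0 D.T) {u : ℕ → ℝ → Euc m}
    {v : ℝ → Euc m} {X : ℕ → ℝ → Euc n} {Y : ℝ → Euc n}
    (hu : ∀ k, MemLp (u k) 2 (volume.restrict (Icc t D.T)))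
    (hv : MemLp v 2 (volume.restrict (Icc t D.T)))
    (huv : WeakL2Tendsto (volume.restrict (Icc t D.T)) u v) {N : ℝ}
    (hN : ∀ k, ∫ s in Icc t D.T, ‖u k s‖ ^ 2 ≤ N)
    (hX : ∀ k, ContinuousOn (X k) (Icc t D.T)) (hY : ContinuousOn Y (Icc t D.T)) {M : ℝ}
    (hM : ∀ k, ∀ s ∈ Icc t D.T, ‖X k s‖ ≤ M)
    (hXY : ∀ s ∈ Icc t D.T, Tendsto (fun k => X k s) atTop (𝓝 (Y s))) {c : ℝ}
    (hc : Tendsto (fun k => ∫ s in Icc t D.T, D.runningCost (X k) (u k) s) atTop (𝓝 c)) :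
    ∫ s in Icc t D.T, D.runningCost Y v s ≤ c := by
  obtain ⟨CQ, hCQ⟩ := exists_bound_of_continuousOn_strip h2.continuous_Q M
  obtain ⟨CS, hCS⟩ := exists_bound_of_continuousOn_strip h2.continuous_S M
  obtain ⟨CR, hCR⟩ := exists_bound_of_continuousOn_strip h2.continuous_R M
  obtain ⟨L, hL, Q₀, -, G₀, -, S₀, -, ε, -, ρ₀, hρ₀, ρ, -, hρ, hb⟩ := h2.bounds
  have hIcc : ∀ r ∈ Icc t D.T, r ∈ Icc 0 D.T := fun r hr => ⟨ht.1.trans hr.1, hr.2⟩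
  have hae : ∀ {p : ℝ → Prop}, (∀ r ∈ Icc t D.T, p r) →
      ∀ᵐ r ∂(volume.restrict (Icc t D.T)), p r := fun h =>
    (ae_restrict_iff' measurableSet_Icc).2 (ae_of_all _ h)
  have hQi : ∀ Z : ℝ → Euc n, ContinuousOn Z (Icc t D.T) →
      IntegrableOn (fun s => D.Q s (Z s)) (Icc t D.T) := fun Z hZ =>
    (continuousOn_along h2.continuous_Q ht hZ).integrableOn_Icc
  have hSR : ∀ Z : ℝ → Euc n, ContinuousOn Z (Icc t D.T) →
      MemLp (fun s => D.S s (Z s) + (D.R s (Z s)).act (v s)) 2 (volume.restrict (Icc t D.T)) :=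
    fun Z hZ => ((continuousOn_along h2.continuous_S ht hZ).memLp_Icc 2).add
      (hv.act (continuousOn_along h2.continuous_R ht hZ))
  have hRi : ∀ Z : ℝ → Euc n, ContinuousOn Z (Icc t D.T) →
      IntegrableOn (fun s => 1 / 2 * inner ℝ ((D.R s (Z s)).act (v s)) (v s)) (Icc t D.T) :=
    fun Z hZ => ((hv.act (continuousOn_along h2.continuous_R ht hZ)).integrable_inner_of_two
      hv).const_mul _
  have hRlim : ∀ s ∈ Icc t D.T,
      Tendsto (fun k => (D.R s (X k s)).act (v s)) atTop (𝓝 ((D.R s (Y s)).act (v s))) := by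
    intro s hs
    have h := (tendsto_along h2.continuous_R (hIcc s hs) (hXY s hs)).prodMk_nhds
      (tendsto_const_nhds (x := v s))
    have h' := (Matrix.continuous_act.tendsto (D.R s (Y s), v s)).comp h
    exact h'
  have hRb : ∀ k, ∀ s ∈ Icc t D.T, ‖(D.R s (X k s)).act (v s)‖ ≤ CR * ‖v s‖ := fun k s hs =>
    (Matrix.norm_act_le _ _).trans (mul_le_mul_of_nonneg_right
      (hCR s (hIcc s hs) _ (hM k s hs)) (norm_nonneg _))
  have hlimQ : Tendsto (fun k => ∫ s in Icc t D.T, D.Q s (X k s)) atTop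
      (𝓝 (∫ s in Icc t D.T, D.Q s (Y s))) :=
    tendsto_integral_of_dominated_convergence (fun _ => CQ)
      (fun k => (hQi _ (hX k)).aestronglyMeasurable) (integrable_const _)
      (fun k => hae fun s hs => hCQ s (hIcc s hs) _ (hM k s hs))
      (hae fun s hs => tendsto_along h2.continuous_Q (hIcc s hs) (hXY s hs))
  have hlimR : Tendsto (fun k => ∫ s in Icc t D.T, 1 / 2 * inner ℝ ((D.R s (X k s)).act (v s)) (v s))
      atTop (𝓝 (∫ s in Icc t D.T, 1 / 2 * inner ℝ ((D.R s (Y s)).act (v s)) (v s))) := by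
    refine tendsto_integral_of_dominated_convergence (fun s => 1 / 2 * (CR * ‖v s‖ ^ 2))
      (fun k => (hRi _ (hX k)).aestronglyMeasurable)
      ((hv.norm.integrable_sq.const_mul CR).const_mul _) (fun k => hae fun s hs => ?_)
      (hae fun s hs => ((hRlim s hs).inner tendsto_const_nhds).const_mul _)
    rw [norm_mul, Real.norm_of_nonneg (by norm_num : (0 : ℝ) ≤ 1 / 2)]
    refine mul_le_mul_of_nonneg_left ?_ (by norm_num)
    refine (norm_inner_le_norm _ _).trans ?_
    have := mul_le_mul_of_nonneg_right (hRb k s hs) (norm_nonneg (v s))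
    linarith
  have hlimSR : Tendsto (fun k => ∫ s in Icc t D.T,
      inner ℝ (D.S s (X k s) + (D.R s (X k s)).act (v s)) (u k s)) atTop
      (𝓝 (∫ s in Icc t D.T, inner ℝ (D.S s (Y s) + (D.R s (Y s)).act (v s)) (v s))) := by
    refine huv.tendsto_integral_inner hu hN (h := fun s => CS + CR * ‖v s‖)
      ((memLp_const CS).add (hv.norm.const_mul CR))
      (fun k => (hSR _ (hX k)).aestronglyMeasurable) (fun k => hae fun s hs => ?_)
      (hae fun s hs =>
        (tendsto_along h2.continuous_S (hIcc s hs) (hXY s hs)).add (hRlim s hs))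
    exact (norm_add_le _ _).trans (add_le_add (hCS s (hIcc s hs) _ (hM k s hs)) (hRb k s hs))
  -- The limit of the costs with the quadratic part replaced by its tangent at `v`: the tangent lies
  -- below the cost at `u k` and agrees with it at `v`.
  have hlim := (hlimQ.add hlimSR).sub hlimR
  have hi : ∀ (Z : ℝ → Euc n) (w : ℝ → Euc m), ContinuousOn Z (Icc t D.T) →
      MemLp w 2 (volume.restrict (Icc t D.T)) → IntegrableOn (fun s => D.Q s (Z s)
        + inner ℝ (D.S s (Z s) + (D.R s (Z s)).act (v s)) (w s)) (Icc t D.T) := fun Z w hZ hw =>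
    (hQi Z hZ).add ((hSR Z hZ).integrable_inner_of_two hw)
  have hsplit : ∀ (Z : ℝ → Euc n) (w : ℝ → Euc m), ContinuousOn Z (Icc t D.T) →
      MemLp w 2 (volume.restrict (Icc t D.T)) → (∫ s in Icc t D.T, D.Q s (Z s))
      + (∫ s in Icc t D.T, inner ℝ (D.S s (Z s) + (D.R s (Z s)).act (v s)) (w s))
      - (∫ s in Icc t D.T, 1 / 2 * inner ℝ ((D.R s (Z s)).act (v s)) (v s))
      = ∫ s in Icc t D.T, (D.Q s (Z s) + inner ℝ (D.S s (Z s) + (D.R s (Z s)).act (v s)) (w s)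
        - 1 / 2 * inner ℝ ((D.R s (Z s)).act (v s)) (v s)) := by
    intro Z w hZ hw
    rw [← integral_add (hQi Z hZ) ((hSR Z hZ).integrable_inner_of_two hw),
      ← integral_sub (hi Z w hZ hw) (hRi Z hZ)]
  have hYv : ∫ s in Icc t D.T, D.runningCost Y v s = (∫ s in Icc t D.T, D.Q s (Y s))
      + (∫ s in Icc t D.T, inner ℝ (D.S s (Y s) + (D.R s (Y s)).act (v s)) (v s))
      - ∫ s in Icc t D.T, 1 / 2 * inner ℝ ((D.R s (Y s)).act (v s)) (v s) := by
    rw [hsplit Y v hY hv]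
    refine integral_congr_ae (ae_of_all _ fun s => ?_)
    simp only [runningCost, inner_add_left]
    ring
  rw [hYv]
  refine le_of_tendsto_of_tendsto' hlim hc fun k => ?_
  rw [hsplit _ _ (hX k) (hu k)]
  refine setIntegral_mono_on ((hi _ _ (hX k) (hu k)).sub (hRi _ (hX k)))
    (h2.integrableOn_runningCost ht (hu k) (hX k)) measurableSet_Icc fun s hs => ?_
  have hR := (hb s (hIcc s hs) (X k s)).1
  have htan := inner_act_tangent_le (h2.symm_R s (hIcc s hs) (X k s))
    (fun w => (mul_nonneg (hρ₀.le.trans (hρ _)) (sq_nonneg _)).trans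
      (hR.mul_norm_sq_le_inner_act w)) (u k s) (v s)
  simp only [runningCost, inner_add_left]
  linarith

/-- One constant serves both purposes: bounding `J` below makes the infimum finite, and bounding `G`
below turns bounds on `J` into bounds on the integrated running cost. -/
lemma H2.exists_neg_le_J (h1 : D.H1) (h2 : D.H2) (ht : t ∈ Icc 0 D.T) (x : Euc n) :
    ∃ b : ℝ, ∀ u ∈ D.Admissible t,
      (∀ y, -b ≤ D.G y) ∧ -b ≤ D.J t x u := by
  obtain ⟨c₀, hc₀, _, _, _, _, hb⟩ := H2.exists_velocity_bound h1 h2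
  obtain ⟨L, hL, Q₀, -, G₀, -, S₀, -, ε, -, ρ₀, -, ρ, -, -, hG⟩ := h2.bounds
  have hτ : 0 ≤ (D.T - t) * c₀ := mul_nonneg (sub_nonneg.2 ht.2) hc₀.le
  refine ⟨L + (D.T - t) * c₀, fun u hu => ?_⟩
  have hG' : ∀ y, -L ≤ D.G y := fun y => (hG t ht y).2.2.1
  refine ⟨fun y => by linarith [hG' y], ?_⟩
  rw [J_eq_setIntegral ht]
  have hX := (h1.isTrajectory_state ht hu.1 x).continuousOn
  have hℓ := h2.integrableOn_runningCost ht hu.1 hX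
  have h3 : 0 ≤ ∫ s in Icc t D.T, (D.runningCost (D.state t x u) u s + c₀) :=
    setIntegral_nonneg measurableSet_Icc fun s hs =>
      (hb s ⟨ht.1.trans hs.1, hs.2⟩ (D.state t x u s) (u s)).1
  rw [integral_add hℓ (integrable_const c₀), setIntegral_const, Real.volume_real_Icc_of_le ht.2,
    smul_eq_mul] at h3
  have := hG' (D.state t x u D.T)
  linarith

/-- The direct method: a weak limit of a minimizing sequence is optimal. -/
lemma H1.exists_isOptimalControl (hU_closed : IsClosed D.U) (hU_convex : Convex ℝ D.U)
    (hU_zero : (0 : Euc m) ∈ D.U) (h1 : D.H1) (h2 : D.H2) (ht : t ∈ Icc 0 D.T) (x : Euc n) :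
    ∃ u, D.IsOptimalControl t x u := by
  obtain ⟨b, hb⟩ := H2.exists_neg_le_J h1 h2 ht x
  have hne : (D.J t x '' D.Admissible t).Nonempty :=
    ⟨_, mem_image_of_mem _ ⟨MemLp.zero, ae_of_all _ fun _ => hU_zero⟩⟩
  have hbdd : BddBelow (D.J t x '' D.Admissible t) :=
    ⟨-b, by rintro _ ⟨u, hu, rfl⟩; exact (hb u hu).2⟩
  obtain ⟨j, -, hj, hjmem⟩ := exists_seq_tendsto_sInf hne hbdd
  choose u hu hju using hjmem
  obtain ⟨K, hK⟩ := hj.bddAbove_range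
  set X : ℕ → ℝ → Euc n := fun k => D.state t x (u k) with hXdef
  have hX : ∀ k, D.IsTrajectory t x (u k) (X k) := fun k => h1.isTrajectory_state ht (hu k).1 x
  have hJ : ∀ k, j k = (∫ s in Icc t D.T, D.runningCost (X k) (u k) s) + D.G (X k D.T) :=
    fun k => by rw [← hju k, J_eq_setIntegral ht]
  have hcost : ∀ k, ∫ s in Icc t D.T, D.runningCost (X k) (u k) s ≤ K + b := by
    intro k
    have h3 := hK (mem_range_self k)
    have h4 := (hb _ (hu k)).1 (X k D.T)
    have h5 := hJ k
    linarith
  obtain ⟨M, hM⟩ := H2.exists_state_bound h1 h2 ht x (K + b)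
  obtain ⟨N, hN⟩ := h2.exists_control_bound ht (K + b) M
  have hM' := fun k => hM _ _ (hu k).1 (hX k) (hcost k)
  have hN' := fun k => hN _ _ (hu k).1 (hX k).continuousOn (hcost k) (hM' k)
  obtain ⟨φ, hφ, v, hv, huv⟩ := exists_subseq_weakL2Tendsto (fun k => (hu k).1) hN'
  have hvU : v ∈ D.Admissible t :=
    ⟨hv, huv.ae_mem (fun k => (hu _).1) hv hU_closed hU_convex fun k => (hu _).2⟩
  have hY := h1.isTrajectory_state ht hv x
  have hXY : ∀ s ∈ Icc t D.T, Tendsto (fun k => X (φ k) s) atTop (𝓝 (D.state t x v s)) :=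
    fun s hs => h1.tendsto_trajectory ht (fun k => (hu _).1) hv huv (fun k => hN' _)
      (fun k => hX _) hY hs
  have hGlim : Tendsto (fun k => D.G (X (φ k) D.T)) atTop (𝓝 (D.G (D.state t x v D.T))) :=
    (h2.continuous_G.tendsto _).comp (hXY D.T (right_mem_Icc.2 ht.2))
  -- The terminal cost converges, so the running costs tend to the infimum minus the terminal cost
  -- of `v`.
  have hclim := (hj.comp hφ.tendsto_atTop).sub hGlim
  have hlsc := h2.integral_runningCost_le ht (fun k => (hu (φ k)).1) hv huv (fun k => hN' _)
    (fun k => (hX _).continuousOn) hY.continuousOn (fun k => hM' _) hXY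
    (hclim.congr fun k => by simp only [Function.comp_apply, hJ]; ring)
  refine ⟨v, hvU, fun w hw => ?_⟩
  have h3 : sInf (D.J t x '' D.Admissible t) ≤ D.J t x w :=
    csInf_le hbdd (mem_image_of_mem _ hw)
  rw [J_eq_setIntegral (u := v) ht]
  linarith

end AQData

theorem proposition3p1 {n m : ℕ} (D : AQData n m)
    (hU_closed : IsClosed D.U) (hU_convex : Convex ℝ D.U) (hU_zero : (0 : Euc m) ∈ D.U)
    (h1 : D.H1) (h2 : D.H2) (t : ℝ) (ht : t ∈ Set.Icc 0 D.T) (x : Euc n) :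
    D.WellPosed t x ∧ ∃ u, D.IsOptimalControl t x u :=
  ⟨h1.wellPosed h2 ht x, h1.exists_isOptimalControl hU_closed hU_convex hU_zero h2 ht x⟩
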